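/- Let $\mathcal A\subset\mathbb R^n$ be finite and let $X\subset\mathbb R^n$ be a nonempty polyhedron (the solution set of finitely many weak linear inequalities). Identify a signomial $\sum_{\alpha\in\mathcal A}c_\alpha e^{\alpha^Tx}$ with its coefficient vector $c\in\mathbb R^{\mathcal A}$. For $\beta\in\mathcal A$ let $C_X(\mathcal A,\beta)$ be the cone of all $c\in\mathbb R^{\mathcal A}$ with $c_\alpha\ge 0$ for all $\alpha\ne\beta$ and $\sum_{\alpha}c_\alpha e^{\alpha^Tx}\ge 0$ for all $x\in X$, and let $C_X(\mathcal A)=\sum_{\beta\in\mathcal A}C_X(\mathcal A,\beta)$ (Minkowski sum). Write $\sigma_X(y)=\sup_{x\in X}y^Tx$, $\mathcal A\nu=\sum_{\alpha}\nu_\alpha\alpha$ and $N_\beta=\{\nu\in\mathbb R^{\mathcal A}:\nu_\alpha\ge 0\ (\alpha\neq\beta),\ \sum_\alpha\nu_\alpha=0\}$. Let $\Lambda_X(\mathcal A,\beta)$ be the set of normalized $X$-circuits at $\beta$: the $\lambda\in N_\beta$ with $\lambda_\beta=-1$ and $\sigma_X(-\mathcal A\lambda)<\infty$ that are not of the form $(1-\theta)\nu^{(1)}+\theta\nu^{(2)}$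 with $0<\theta<1$ and linearly independent $\nu^{(1)},\nu^{(2)}\in N_\beta$ such that $\nu\mapsto\sigma_X(-\mathcal A\nu)$ is finite and linear (i.e. affine) on the segment $[\nu^{(1)},\nu^{(2)}]$. For $\lambda\in\Lambda_X(\mathcal A,\beta)$ the $\lambda$-witnessed AGE cone is $$C_X(\mathcal A,\lambda)=\Big\{c\in\mathbb R^{\mathcal A}:\ c_\alpha\ge 0\ (\alpha\ne\beta),\ \prod_{\alpha:\lambda_\alpha>0}\Big(\frac{c_\alpha}{\lambda_\alpha}\Big)^{\lambda_\alpha}\ge -c_\beta\, e^{\sigma_X(-\mathcal A\lambda)}\Big\}.$$ A set $S\subset\mathbb R^N$ is representable by a family of cones if there are finitely many cones $K_1,\dots,K_m$ in the family, an integer $p\ge 0$ and affine maps $F_j$ on $\mathbb R^N\times\mathbb R^p$ with $S=\{x:\exists u\in\mathbb R^p,\ F_j(x,u)\in K_j \text{ for all } j\}$. It is power cone representable if this holds for the family of cones $\{(z,t)\in\mathbb R_{\ge0}^k\times\mathbb R:\prod_i z_i^{w_i}\ge|t|\}$ with $k\ge1$, $w_i>0$, $\sum_iw_i=1$, and second-order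 representable if it holds for the family of cones $\{(z,t)\in\mathbb R^k\times\mathbb R:\|z\|_2\le t\}$, $k\ge 0$. Its semidefinite extension degree is the least $k$ such that it is representable using only the cone of positive semidefinite symmetric $k\times k$ matrices. Then: 1. Each $\Lambda_X(\mathcal A,\beta)$ is finite, and $$C_X(\mathcal A)=\mathbb R_{\ge 0}^{\mathcal A}+\sum_{\beta\in\mathcal A}\ \sum_{\lambda\in\Lambda_X(\mathcal A,\beta)}C_X(\mathcal A,\lambda);$$ if at least one $\Lambda_X(\mathcal A,\beta)$ is nonempty, the summand $\mathbb R_{\ge0}^{\mathcal A}$ may be omitted. 2. $C_X(\mathcal A)$ is power cone representable. 3. If moreover $\mathcal A^TX=\{(\alpha^Tx)_{\alpha\in\mathcal A}:x\in X\}\subset\mathbb R^{\mathcal A}$ is a rational polyhedron (the solution set of finitely many weak linear inequalities with rational coefficients and right-hand sides), then $C_X(\mathcal A)$ is second-order representable and its semidefinite extension degree is at most $2$; it is equal to $2$ if and only if $C_X(\mathcal A)$ is not a polyhedron. -/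

import Mathlib

open scoped Pointwise BigOperators Matrix

noncomputable section

namespace Sage

/-! ### Polyhedra -/

/-- A polyhedron: the solution set of finitely many weak linear inequalities. -/
def IsPolyhedron {ι : Type} [Fintype ι] (S : Set (ι → ℝ)) : Prop :=
  ∃ (m : ℕ) (M : Matrix (Fin m) ι ℝ) (b : Fin m → ℝ), S = {x | M *ᵥ x ≤ b}

/-- A rational polyhedron: the solution set of finitely many weak linear inequalities with
rational data. -/
def IsRationalPolyhedron {ι : Type} [Fintype ι] (S : Set (ι → ℝ)) : Prop :=
  ∃ (m : ℕ) (M : Matrix (Fin m) ι ℚ) (b : Fin m → ℚ),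
    S = {x | M.map (fun q : ℚ => (q : ℝ)) *ᵥ x ≤ fun i => (b i : ℝ)}

/-! ### Conic lifts and representability -/

/-- `S` is the projection (onto the `x`-coordinates) of a set of pairs `(x, u)` described by the
finitely many constraints `F j (x, u) ∈ K j`, where the `F j` are affine maps. -/
def HasLift {ι : Type} [Fintype ι] (S : Set (ι → ℝ)) {m : ℕ} (W : Fin m → Type)
    [∀ j, AddCommGroup (W j)] [∀ j, Module ℝ (W j)] (K : ∀ j, Set (W j)) : Prop :=
  ∃ (p : ℕ) (F : ∀ j, ((ι → ℝ) × (Fin p → ℝ)) →ᵃ[ℝ] W j),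
    S = {x | ∃ u : Fin p → ℝ, ∀ j, F j (x, u) ∈ K j}

/-- The power cone with weights `w`. -/
def powerCone {k : ℕ} (w : Fin k → ℝ) : Set ((Fin k → ℝ) × ℝ) :=
  {z | (∀ i, 0 ≤ z.1 i) ∧ |z.2| ≤ ∏ i, z.1 i ^ w i}

/-- Representable by finitely many power cone constraints; the weights of each power cone are
positive and sum to one. -/
def PowerConeRepresentable {ι : Type} [Fintype ι] (S : Set (ι → ℝ)) : Prop :=
  ∃ (m : ℕ) (k : Fin m → ℕ) (w : ∀ j, Fin (k j) → ℝ),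
    (∀ j i, 0 < w j i) ∧ (∀ j, ∑ i, w j i = 1) ∧
      HasLift S (fun j => (Fin (k j) → ℝ) × ℝ) (fun j => powerCone (w j))

/-- The second-order (Lorentz) cone of dimension `k + 1`. -/
def lorentzCone (k : ℕ) : Set ((Fin k → ℝ) × ℝ) :=
  {z | √(∑ i, z.1 i ^ 2) ≤ z.2}

/-- Representable by finitely many second-order cone constraints. -/
def SecondOrderRepresentable {ι : Type} [Fintype ι] (S : Set (ι → ℝ)) : Prop :=
  ∃ (m : ℕ) (k : Fin m → ℕ),
    HasLift S (fun j => (Fin (k j) → ℝ) × ℝ) (fun j => lorentzCone (k j))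

/-- `S` has an extended formulation by finitely many linear matrix inequalities of size `k`.
(`Matrix.PosSemidef` contains symmetry of the matrix.) -/
def HasSemidefiniteLift {ι : Type} [Fintype ι] (S : Set (ι → ℝ)) (k : ℕ) : Prop :=
  ∃ m : ℕ, HasLift S (fun _ : Fin m => Matrix (Fin k) (Fin k) ℝ)
    (fun _ => {M | M.PosSemidef})

/-- The semidefinite extension degree: the least `k` such that `S` has an extended formulation by
finitely many linear matrix inequalities of size `k` (and `⊤` if there is none). -/
def semidefiniteExtensionDegree {ι : Type} [Fintype ι] (S : Set (ι → ℝ)) : ℕ∞ :=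
  sInf ((fun k : ℕ => (k : ℕ∞)) '' {k | HasSemidefiniteLift S k})

/-! ### Signomials and SAGE cones, as cones of coefficient vectors -/

variable {n : ℕ}

/-- The signomial with exponent set `A` and coefficient vector `c`. -/
def signomial (A : Finset (Fin n → ℝ)) (c : A → ℝ) (x : Fin n → ℝ) : ℝ :=
  ∑ α : A, c α * Real.exp ((α : Fin n → ℝ) ⬝ᵥ x)

/-- The `X`-AGE cone of `β`: signomials nonnegative on `X` all of whose coefficients, except
possibly the one at `β`, are nonnegative. -/
def ageCone (X : Set (Fin n → ℝ)) (A : Finset (Fin n → ℝ)) (β : A) : Set (A → ℝ) :=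
  {c | (∀ α, α ≠ β → 0 ≤ c α) ∧ ∀ x ∈ X, 0 ≤ signomial A c x}

/-- The `X`-SAGE cone: the Minkowski sum of the `X`-AGE cones. -/
def sageCone (X : Set (Fin n → ℝ)) (A : Finset (Fin n → ℝ)) : Set (A → ℝ) :=
  ∑ β : A, ageCone X A β

/-! ### Sublinear circuits -/

/-- The vector `∑ α, ν α • α`. -/
def applyExponents (A : Finset (Fin n → ℝ)) (ν : A → ℝ) : Fin n → ℝ :=
  ∑ α : A, ν α • (α : Fin n → ℝ)

/-- The image of `X` under the map `x ↦ (α ⬝ᵥ x)_α` adjoint to `applyExponents`. -/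
def transposeImage (A : Finset (Fin n → ℝ)) (X : Set (Fin n → ℝ)) : Set (A → ℝ) :=
  (fun x (α : A) => (α : Fin n → ℝ) ⬝ᵥ x) '' X

/-- The support function of `X` is finite at `y` (for nonempty `X`). -/
def SupportFinite (X : Set (Fin n → ℝ)) (y : Fin n → ℝ) : Prop :=
  BddAbove ((fun x => y ⬝ᵥ x) '' X)

/-- The value at `y` of the support function of `X`; meaningful where `SupportFinite X y`. -/
def supportFun (X : Set (Fin n → ℝ)) (y : Fin n → ℝ) : ℝ :=
  sSup ((fun x => y ⬝ᵥ x) '' X)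

/-- Vectors with zero sum whose entries, except possibly the one at `β`, are nonnegative. -/
def coneN (A : Finset (Fin n → ℝ)) (β : A) : Set (A → ℝ) :=
  {ν | (∀ α, α ≠ β → 0 ≤ ν α) ∧ ∑ α, ν α = 0}

/-- The function `ν ↦ σ_X(-A ν)` is (finite and) linear on the segment `[ν₁, ν₂]`. -/
def LinearOnSegment (X : Set (Fin n → ℝ)) (A : Finset (Fin n → ℝ)) (ν₁ ν₂ : A → ℝ) : Prop :=
  SupportFinite X (-applyExponents A ν₁) ∧ SupportFinite X (-applyExponents A ν₂) ∧
    ∀ t ∈ Set.Icc (0 : ℝ) 1,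
      supportFun X (-applyExponents A ((1 - t) • ν₁ + t • ν₂)) =
        (1 - t) * supportFun X (-applyExponents A ν₁) +
          t * supportFun X (-applyExponents A ν₂)

/-- `ν`, an element of `coneN A β`, is an `X`-circuit of `A`: it is nonzero, the support function
is finite at `-A ν`, and `ν` is not a proper convex combination of two non-proportional vectors of
`coneN A β` on whose segment `σ_X(-A ·)` is linear. -/
def IsCircuit (X : Set (Fin n → ℝ)) (A : Finset (Fin n → ℝ)) (β : A) (ν : A → ℝ) : Prop :=
  ν ∈ coneN A β ∧ ν ≠ 0 ∧ SupportFinite X (-applyExponents A ν) ∧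
    ¬ ∃ ν₁ ∈ coneN A β, ∃ ν₂ ∈ coneN A β, LinearIndependent ℝ ![ν₁, ν₂] ∧
      LinearOnSegment X A ν₁ ν₂ ∧ ν ∈ openSegment ℝ ν₁ ν₂

/-- The normalized `X`-circuits of `A` whose negative entry is at `β`. -/
def normalizedCircuits (X : Set (Fin n → ℝ)) (A : Finset (Fin n → ℝ)) (β : A) :
    Set (A → ℝ) :=
  {l | IsCircuit X A β l ∧ l β = -1}

/-- The `l`-witnessed AGE cone, for `l ∈ coneN A β` with `l β = -1` and `σ_X(-A l)` finite. -/
def witnessedCone (X : Set (Fin n → ℝ)) (A : Finset (Fin n → ℝ)) (β : A) (l : A → ℝ) :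
    Set (A → ℝ) :=
  {c | (∀ α, α ≠ β → 0 ≤ c α) ∧
    -c β * Real.exp (supportFun X (-applyExponents A l)) ≤
      ∏ α : A with 0 < l α, (c α / l α) ^ l α}

end Sage

end

open Sage

/-!
The cones depend on `X` only through the polyhedron `Y = transposeImage A X`: the value of the
signomial `c` at `x` is `∑ c α * exp (y α)` at the corresponding point `y ∈ Y`, and
`σ_X(-A ν) = sup_{y ∈ Y} -(ν ⬝ᵥ y)`. This supremum, where finite, is attained
(`IsPolyhedral.exists_isMinOn`), and for `y ∈ Y` the normalized `ν` minimized at `y` form a compact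
convex set (`linearityCell`) on which `σ_X(-A ·)` is linear. The normalized circuits are the extreme
points of these cells: linearity on a segment means that both ends share a minimizer.

*Finiteness and rationality.* By complementary slackness (`exists_multipliers`) a normalized circuit
`ν` satisfies `-ν = z ᵥ* M` with multipliers `z ≥ 0` on active inequalities of `Y = {y | M y ≤ b}`,
and it is the only solution of the linear system determined by the supports of `ν` and `z`
(`eq_circuit_of_support`). There are finitely many supports, and a rational system with a unique
real solution has a rational solution.

*Decomposition.* If `c` is an AGE signomial with `c β < 0`, then the open convex set of all `s` at
which the negative term dominates is disjoint from `Y`; a separating functional is a witness `ν`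
(`exists_witness`). By the Krein–Milman theorem `ν` is a convex combination of circuits in the
linearity cell of a minimizer (`exists_circuit_combination`), and the weighted inequality between
arithmetic and geometric mean splits `c` accordingly (`exists_split`). The same inequality shows
that witnessed cones consist of AGE signomials.

*Representability.* Representable sets are closed under intersections, projections, linear preimages
and Minkowski sums, so it suffices to represent the weighted geometric mean given by a circuit,
which is a power cone. For rational weights it is expressed by a binary tree of geometric means of
two variables, that is, by rotated quadratic cones, which are both second-order cones and cones of
semidefinite `2 × 2` matrices. Finally, sets with semidefinite lifts of size at most one are
projections of polyhedra, hence polyhedra by Fourier–Motzkin elimination.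
-/


/-! ### Polyhedra in vector spaces and Fourier–Motzkin elimination -/

/-- A subset of a real vector space cut out by finitely many weak linear inequalities. Unlike
`Sage.IsPolyhedron` this is free of coordinates. -/
def IsPolyhedral {E : Type*} [AddCommGroup E] [Module ℝ E] (S : Set E) : Prop :=
  ∃ (J : Type) (_ : Finite J) (f : J → E →ₗ[ℝ] ℝ) (b : J → ℝ), S = {x | ∀ j, f j x ≤ b j}

section Polyhedral

variable {E V : Type*} [AddCommGroup E] [Module ℝ E] [AddCommGroup V] [Module ℝ V]

lemma exists_eq_dotProduct {ι : Type*} [Fintype ι] (f : (ι → ℝ) →ₗ[ℝ] ℝ) :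
    ∃ d : ι → ℝ, ∀ w, f w = d ⬝ᵥ w := by
  classical
  obtain ⟨d, rfl⟩ := (dotProductEquiv ℝ ι).surjective f
  exact ⟨d, fun _ => rfl⟩

lemma isPolyhedral_iff_isPolyhedron {ι : Type} [Fintype ι] {S : Set (ι → ℝ)} :
    IsPolyhedral S ↔ IsPolyhedron S := by
  classical
  constructor
  · rintro ⟨J, _, f, b, rfl⟩
    obtain ⟨m, ⟨e⟩⟩ := Finite.exists_equiv_fin J
    choose d hd using fun j => exists_eq_dotProduct (f j)
    refine ⟨m, Matrix.of fun i => d (e.symm i), fun i => b (e.symm i), ?_⟩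
    ext x
    have key : ∀ i, ((Matrix.of fun i => d (e.symm i)) *ᵥ x) i = f (e.symm i) x :=
      fun i => (hd _ x).symm
    simp only [Set.mem_ofPred_eq, Pi.le_def, key]
    exact ⟨fun h i => h _, fun h j => by simpa using h (e j)⟩
  · rintro ⟨m, M, b, rfl⟩
    exact ⟨Fin m, inferInstance, fun i => (LinearMap.proj i).comp M.mulVecLin, b, by
      ext x; simp [Pi.le_def]⟩

lemma IsPolyhedral.comap {S : Set V} (hS : IsPolyhedral S) (g : E →ᵃ[ℝ] V) :
    IsPolyhedral (g ⁻¹' S) := by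
  obtain ⟨J, _, f, b, rfl⟩ := hS
  refine ⟨J, inferInstance, fun j => (f j).comp g.linear, fun j => b j - f j (g 0), ?_⟩
  ext x
  have h : g x = g.linear x + g 0 := congrFun (AffineMap.decomp g) x
  simp only [Set.mem_preimage, Set.mem_ofPred_eq, h, map_add, LinearMap.comp_apply]
  exact forall_congr' fun j => le_sub_iff_add_le.symm

lemma IsPolyhedral.inter {S T : Set E} (hS : IsPolyhedral S) (hT : IsPolyhedral T) :
    IsPolyhedral (S ∩ T) := by
  obtain ⟨J, _, f, b, rfl⟩ := hS
  obtain ⟨J', _, f', b', rfl⟩ := hT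
  exact ⟨J ⊕ J', inferInstance, Sum.elim f f', Sum.elim b b', by ext x; simp⟩

lemma isPolyhedral_le (f : E →ₗ[ℝ] ℝ) (b : ℝ) : IsPolyhedral {x | f x ≤ b} :=
  ⟨Unit, inferInstance, fun _ => f, fun _ => b, by simp⟩

lemma isPolyhedral_iInter {J : Type} [Finite J] {S : J → Set E} (h : ∀ j, IsPolyhedral (S j)) :
    IsPolyhedral {x | ∀ j, x ∈ S j} := by
  choose K hK f b hS using h
  refine ⟨Σ j, K j, inferInstance, fun p => f p.1 p.2, fun p => b p.1 p.2, ?_⟩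
  ext x
  simp only [hS, Set.mem_ofPred_eq, Sigma.forall]

/-- A real number can be squeezed between two finite families as soon as each lower bound is below
each upper bound. -/
lemma exists_between_of_finite {L U : Type*} [Finite L] [Finite U] (l : L → ℝ) (u : U → ℝ)
    (h : ∀ i j, l i ≤ u j) : ∃ t, (∀ i, l i ≤ t) ∧ ∀ j, t ≤ u j := by
  cases nonempty_fintype L
  cases nonempty_fintype U
  rcases isEmpty_or_nonempty L with hL | hL
  · rcases isEmpty_or_nonempty U with hU | hU
    · exact ⟨0, fun i => hL.elim i, fun j => hU.elim j⟩
    · exact ⟨Finset.univ.inf' Finset.univ_nonempty u, fun i => hL.elim i,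
        fun j => Finset.inf'_le _ (Finset.mem_univ j)⟩
  · exact ⟨Finset.univ.sup' Finset.univ_nonempty l,
      fun i => Finset.le_sup' _ (Finset.mem_univ i),
      fun j => Finset.sup'_le _ _ fun i _ => h i j⟩

/-- Fourier–Motzkin elimination of one variable: every upper bound for the eliminated variable is
paired with every lower bound. -/
lemma IsPolyhedral.exists_real {S : Set (E × ℝ)} (hS : IsPolyhedral S) :
    IsPolyhedral {x | ∃ t, (x, t) ∈ S} := by
  obtain ⟨J, _, f, b, rfl⟩ := hS
  let a : J → ℝ := fun j => f j (0, 1)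
  let g : J → E →ₗ[ℝ] ℝ := fun j => (f j).comp (LinearMap.inl ℝ E ℝ)
  have hf : ∀ j x t, f j (x, t) = g j x + a j * t := fun j x t => by
    have : (x, t) = (x, (0 : ℝ)) + t • ((0 : E), (1 : ℝ)) := by simp
    rw [this, map_add, map_smul, smul_eq_mul, mul_comm]
    rfl
  refine ⟨{j // a j = 0} ⊕ {j // 0 < a j} × {j // a j < 0}, inferInstance,
    Sum.elim (fun j => g j) (fun p => (a p.1)⁻¹ • g p.1 - (a p.2)⁻¹ • g p.2),
    Sum.elim (fun j => b j) (fun p => (a p.1)⁻¹ * b p.1 - (a p.2)⁻¹ * b p.2), ?_⟩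
  ext x
  simp only [Set.mem_ofPred_eq, hf, Sum.forall, Sum.elim_inl, Sum.elim_inr, Prod.forall,
    Subtype.forall]
  have hpos : ∀ j t, 0 < a j → (g j x + a j * t ≤ b j ↔ t ≤ (a j)⁻¹ * (b j - g j x)) :=
    fun j t h => by rw [inv_mul_eq_div, le_div_iff₀ h]; constructor <;> intro <;> linarith
  have hneg : ∀ j t, a j < 0 → (g j x + a j * t ≤ b j ↔ (a j)⁻¹ * (b j - g j x) ≤ t) :=
    fun j t h => by rw [inv_mul_eq_div, div_le_iff_of_neg h]; constructor <;> intro <;> linarith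
  constructor
  · rintro ⟨t, ht⟩
    refine ⟨fun j hj => by simpa [hj] using ht j, fun i hi j hj => ?_⟩
    have := ((hneg j t hj).1 (ht j)).trans ((hpos i t hi).1 (ht i))
    simp only [LinearMap.sub_apply, LinearMap.smul_apply, smul_eq_mul]
    linarith
  · rintro ⟨h0, h1⟩
    obtain ⟨t, hl, hu⟩ := exists_between_of_finite
      (fun j : {j // a j < 0} => (a j)⁻¹ * (b j - g j x))
      (fun j : {j // 0 < a j} => (a j)⁻¹ * (b j - g j x)) (fun j i => by
        have := h1 i i.2 j j.2
        simp only [LinearMap.sub_apply, LinearMap.smul_apply, smul_eq_mul] at this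
        linarith)
    refine ⟨t, fun j => ?_⟩
    rcases lt_trichotomy (a j) 0 with h | h | h
    · exact (hneg j t h).2 (hl ⟨j, h⟩)
    · simpa [h] using h0 j h
    · exact (hpos j t h).2 (hu ⟨j, h⟩)

lemma IsPolyhedral.exists_fin {p : ℕ} :
    ∀ {E : Type*} [AddCommGroup E] [Module ℝ E] {S : Set (E × (Fin p → ℝ))}, IsPolyhedral S →
      IsPolyhedral {x | ∃ u, (x, u) ∈ S} := by
  induction p with
  | zero =>
    intro E _ _ S hS
    convert hS.comap (LinearMap.inl ℝ E (Fin 0 → ℝ)).toAffineMap using 1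
    ext x
    exact ⟨fun ⟨u, hu⟩ => by simpa [Subsingleton.elim u 0] using hu, fun h => ⟨0, h⟩⟩
  | succ p ih =>
    intro E _ _ S hS
    let e : ((E × ℝ) × (Fin p → ℝ)) →ₗ[ℝ] E × (Fin (p + 1) → ℝ) :=
      ((LinearMap.fst ℝ E ℝ).comp (LinearMap.fst ℝ (E × ℝ) (Fin p → ℝ))).prod
        ((Fin.consLinearEquiv ℝ fun _ => ℝ).toLinearMap.comp
          (((LinearMap.snd ℝ E ℝ).comp (LinearMap.fst ℝ (E × ℝ) (Fin p → ℝ))).prod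
            (LinearMap.snd ℝ (E × ℝ) (Fin p → ℝ))))
    convert (ih (hS.comap e.toAffineMap)).exists_real using 1
    ext x
    constructor
    · rintro ⟨u, hu⟩
      refine ⟨u 0, Fin.tail u, ?_⟩
      have : e ((x, u 0), Fin.tail u) = (x, u) :=
        Prod.ext rfl (Fin.cons_self_tail u)
      simpa [this] using hu
    · rintro ⟨t, u, h⟩
      exact ⟨_, h⟩

/-- Projections of polyhedral sets along finite-dimensional spaces are polyhedral. -/
lemma IsPolyhedral.exists [FiniteDimensional ℝ V] {S : Set (E × V)} (hS : IsPolyhedral S) :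
    IsPolyhedral {x | ∃ v, (x, v) ∈ S} := by
  let e := (Module.finBasis ℝ V).equivFun
  convert IsPolyhedral.exists_fin (hS.comap
    (LinearMap.prodMap LinearMap.id e.symm.toLinearMap).toAffineMap) using 1
  ext x
  exact ⟨fun ⟨v, hv⟩ => ⟨e v, by simpa using hv⟩, fun ⟨u, hu⟩ => ⟨e.symm u, hu⟩⟩

lemma IsPolyhedral.eq (f : E →ₗ[ℝ] V) [FiniteDimensional ℝ V] : IsPolyhedral {x | f x = 0} := by
  let e := (Module.finBasis ℝ V).equivFun
  have : {x | f x = 0} = {x | ∀ j, x ∈ {x | ((LinearMap.proj j).comp (e.toLinearMap.comp f)) x ≤ 0}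
      ∩ {x | (-((LinearMap.proj j).comp (e.toLinearMap.comp f))) x ≤ 0}} := by
    ext x
    have : f x = 0 ↔ e (f x) = 0 := by simp
    rw [Set.mem_ofPred_eq, this, funext_iff]
    refine forall_congr' fun j => ?_
    simp [le_antisymm_iff]
  rw [this]
  exact isPolyhedral_iInter fun j => (isPolyhedral_le _ _).inter (isPolyhedral_le _ _)

lemma IsPolyhedral.image [FiniteDimensional ℝ E] [FiniteDimensional ℝ V] {S : Set E}
    (hS : IsPolyhedral S) (f : E →ₗ[ℝ] V) : IsPolyhedral (f '' S) := by
  have h := ((hS.comap (LinearMap.snd ℝ V E).toAffineMap).inter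
    (IsPolyhedral.eq (f.comp (LinearMap.snd ℝ V E) - LinearMap.fst ℝ V E))).exists
  convert h using 1
  ext x
  simp [sub_eq_zero]

lemma IsPolyhedral.isClosed {ι : Type*} [Finite ι] {S : Set (ι → ℝ)} (hS : IsPolyhedral S) :
    IsClosed S := by
  obtain ⟨J, _, f, b, rfl⟩ := hS
  simp only [Set.ofPred_forall]
  exact isClosed_iInter fun j =>
    isClosed_le (f j).continuous_of_finiteDimensional continuous_const

end Polyhedral

/-! ### Linear programming over polyhedra -/

section LinearProgramming

variable {ι J : Type*} [Fintype ι] [Fintype J]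

/-- A linear functional bounded below on a nonempty polyhedron attains its minimum. The set of its
values is a polyhedron in `ℝ`, hence closed. -/
lemma IsPolyhedral.exists_isMinOn {Y : Set (ι → ℝ)} (hY : IsPolyhedral Y) (hne : Y.Nonempty)
    (v : ι → ℝ) (hb : BddBelow ((fun y => v ⬝ᵥ y) '' Y)) :
    ∃ y ∈ Y, ∀ y' ∈ Y, v ⬝ᵥ y ≤ v ⬝ᵥ y' := by
  let f : (ι → ℝ) →ₗ[ℝ] (Unit → ℝ) := LinearMap.pi fun _ => dotProductBilin ℝ ℝ v
  have hc : IsClosed ((fun y => v ⬝ᵥ y) '' Y) := by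
    have h := (hY.image f).isClosed.preimage (f := fun t : ℝ => fun _ : Unit => t) (by fun_prop)
    convert h using 1
    ext t
    simp only [Set.mem_image, Set.mem_preimage]
    refine exists_congr fun y => and_congr_right fun _ => ?_
    exact ⟨fun h => funext fun _ => h, fun h => congrFun h ()⟩
  obtain ⟨y, hy, h⟩ := hc.csInf_mem (hne.image _) hb
  refine ⟨y, hy, fun y' hy' => ?_⟩
  simp only at h
  rw [h]
  exact csInf_le hb ⟨y', hy', rfl⟩

/-- Farkas' lemma. -/
lemma exists_nonneg_combination (a : J → ι → ℝ) (v : ι → ℝ)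
    (h : ∀ d, (∀ j, a j ⬝ᵥ d ≤ 0) → v ⬝ᵥ d ≤ 0) : ∃ z : J → ℝ, 0 ≤ z ∧ v = ∑ j, z j • a j := by
  classical
  let f : (J → ℝ) →ₗ[ℝ] (ι → ℝ) := Fintype.linearCombination ℝ a
  let C : Set (ι → ℝ) := f '' {z | 0 ≤ z}
  have hpos : IsPolyhedral {z : J → ℝ | 0 ≤ z} := by
    obtain ⟨m, ⟨e⟩⟩ := Finite.exists_equiv_fin J
    refine ⟨Fin m, inferInstance, fun j => -LinearMap.proj (e.symm j), 0, ?_⟩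
    ext z
    simp only [Set.mem_ofPred_eq, Pi.le_def]
    exact ⟨fun h j => by simpa using h _, fun h j => by simpa using h (e j)⟩
  have hcl : IsClosed C := (hpos.image f).isClosed
  have hcv : Convex ℝ C := (convex_Ici (0 : J → ℝ)).linear_image f
  by_contra hcon
  have hv : v ∉ C := fun ⟨z, hz, hzv⟩ => hcon ⟨z, hz, hzv ▸ Fintype.linearCombination_apply ..⟩
  obtain ⟨φ, r, hr, hrv⟩ := geometric_hahn_banach_closed_point hcv hcl hv
  obtain ⟨d, hd⟩ := exists_eq_dotProduct (φ : (ι → ℝ) →ₗ[ℝ] ℝ)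
  have hφ : ∀ w : ι → ℝ, φ w = w ⬝ᵥ d := fun w => (hd w).trans (dotProduct_comm _ _)
  have h0 : 0 < r := by simpa using hr 0 ⟨0, by simp, map_zero f⟩
  have hle : ∀ j, φ (a j) ≤ 0 := fun j => by
    by_contra! hj
    -- a large multiple of `a j` violates the bound `r`
    have := hr ((r / φ (a j)) • a j) ⟨Pi.single j (r / φ (a j)), by
      simp only [Set.mem_ofPred_eq, Pi.single_nonneg]; positivity, by
      simp [f, Fintype.linearCombination_apply, Pi.single_apply, ite_smul]⟩
    rw [map_smul, smul_eq_mul, div_mul_cancel₀ _ hj.ne'] at this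
    exact lt_irrefl _ this
  have := h d fun j => by rw [← hφ]; exact hle j
  rw [← hφ] at this
  linarith

/-- Complementary slackness: if `v` is minimized over `{y | M y ≤ b}` at `y`, then `-v` is a
nonnegative combination of the rows which are active at `y`. -/
lemma exists_multipliers (M : Matrix J ι ℝ) (b : J → ℝ) (v y : ι → ℝ) (hy : M *ᵥ y ≤ b)
    (hmin : ∀ y', M *ᵥ y' ≤ b → v ⬝ᵥ y ≤ v ⬝ᵥ y') :
    ∃ z : J → ℝ, 0 ≤ z ∧ (∀ j, z j ≠ 0 → (M *ᵥ y) j = b j) ∧ -v = z ᵥ* M := by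
  classical
  obtain ⟨z, hz, hzv⟩ := exists_nonneg_combination
    (fun j : {j // (M *ᵥ y) j = b j} => M j) (-v) (fun d hd => by
      -- moving from `y` a little in direction `d` stays inside the polyhedron
      have hlim : ∀ᶠ ε in nhdsWithin (0 : ℝ) (Set.Ioi 0), ∀ j, (M *ᵥ y) j + ε * (M *ᵥ d) j ≤ b j := by
        rw [Filter.eventually_all]
        intro j
        by_cases hj : (M *ᵥ y) j = b j
        · filter_upwards [self_mem_nhdsWithin] with ε hε
          have : (M *ᵥ d) j ≤ 0 := hd ⟨j, hj⟩
          have := mul_nonpos_of_nonneg_of_nonpos (le_of_lt hε) this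
          linarith
        · have hlt : (M *ᵥ y) j + 0 * (M *ᵥ d) j < b j := by
            simpa using lt_of_le_of_ne (hy j) hj
          have hc : ContinuousAt (fun ε : ℝ => (M *ᵥ y) j + ε * (M *ᵥ d) j) 0 := by fun_prop
          exact ((hc.eventually_lt continuousAt_const hlt).filter_mono nhdsWithin_le_nhds).mono
            fun _ h => h.le
      obtain ⟨ε, hε, hε0⟩ := (hlim.and self_mem_nhdsWithin).exists
      have := hmin (y + ε • d) fun j => by
        simpa [Matrix.mulVec_add, Matrix.mulVec_smul] using hε j
      rw [dotProduct_add, dotProduct_smul, smul_eq_mul] at this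
      have hε0 : 0 < ε := hε0
      rw [neg_dotProduct, neg_nonpos]
      exact nonneg_of_mul_nonneg_right (by linarith) hε0)
  refine ⟨fun j => if h : (M *ᵥ y) j = b j then z ⟨j, h⟩ else 0, fun j => ?_, fun j hj => ?_, ?_⟩
  · dsimp only
    split_ifs with h
    exacts [hz _, le_rfl]
  · by_contra h
    simp [h] at hj
  · rw [hzv]
    ext i
    simp only [Finset.sum_apply, Pi.smul_apply, smul_eq_mul, Matrix.vecMul, dotProduct, dite_mul,
      zero_mul]
    rw [← Finset.sum_filter_add_sum_filter_not Finset.univ (fun j => (M *ᵥ y) j = b j),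
      Finset.sum_eq_zero (s := Finset.univ.filter fun j => ¬ (M *ᵥ y) j = b j), add_zero,
      ← Finset.sum_subtype_eq_sum_filter]
    · simp only [Finset.subtype_univ]
      exact Finset.sum_congr rfl fun j _ => by rw [dif_pos j.2]
    · intro j hj
      rw [dif_neg (Finset.mem_filter.1 hj).2]

end LinearProgramming

/-! ### Sublinear circuits of a polyhedron -/

section Circuits

variable {n : ℕ} {X : Set (Fin n → ℝ)} {A : Finset (Fin n → ℝ)} {β : A} {ν ν₁ ν₂ y : A → ℝ}

/-- `y` minimizes the linear functional `ν ⬝ᵥ ·` over `Y`. For `Y = transposeImage A X` this says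
that the support function `σ_X` at `-A ν` is attained at the point of `X` corresponding to `y`. -/
def Minimizes (Y : Set (A → ℝ)) (y ν : A → ℝ) : Prop :=
  y ∈ Y ∧ ∀ y' ∈ Y, ν ⬝ᵥ y ≤ ν ⬝ᵥ y'

lemma neg_applyExponents_dotProduct (ν : A → ℝ) (x : Fin n → ℝ) :
    -applyExponents A ν ⬝ᵥ x = -(ν ⬝ᵥ fun α : A => (α : Fin n → ℝ) ⬝ᵥ x) := by
  rw [applyExponents, neg_dotProduct, sum_dotProduct]
  simp only [smul_dotProduct, smul_eq_mul]
  rfl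

lemma image_support_eq (ν : A → ℝ) :
    (fun x => -applyExponents A ν ⬝ᵥ x) '' X = (fun y => -(ν ⬝ᵥ y)) '' transposeImage A X := by
  simp only [transposeImage, Set.image_image, neg_applyExponents_dotProduct]

lemma neg_dotProduct_le_supportFun (h : SupportFinite X (-applyExponents A ν))
    (hy : y ∈ transposeImage A X) : -(ν ⬝ᵥ y) ≤ supportFun X (-applyExponents A ν) := by
  rw [SupportFinite, image_support_eq] at h
  rw [supportFun, image_support_eq]
  exact le_csSup h ⟨y, hy, rfl⟩

lemma Minimizes.supportFinite (h : Minimizes (transposeImage A X) y ν) :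
    SupportFinite X (-applyExponents A ν) := by
  rw [SupportFinite, image_support_eq]
  refine ⟨-(ν ⬝ᵥ y), ?_⟩
  rintro _ ⟨y', hy', rfl⟩
  exact neg_le_neg (h.2 y' hy')

lemma Minimizes.supportFun_eq (h : Minimizes (transposeImage A X) y ν) :
    supportFun X (-applyExponents A ν) = -(ν ⬝ᵥ y) := by
  refine le_antisymm ?_ (neg_dotProduct_le_supportFun h.supportFinite h.1)
  rw [supportFun, image_support_eq]
  refine csSup_le (Set.Nonempty.image _ ⟨y, h.1⟩) ?_
  rintro _ ⟨y', hy', rfl⟩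
  exact neg_le_neg (h.2 y' hy')

lemma minimizes_of_supportFun_le (h : SupportFinite X (-applyExponents A ν))
    (hy : y ∈ transposeImage A X) (hle : supportFun X (-applyExponents A ν) ≤ -(ν ⬝ᵥ y)) :
    Minimizes (transposeImage A X) y ν :=
  ⟨hy, fun _ hy' => neg_le_neg_iff.1 ((neg_dotProduct_le_supportFun h hy').trans hle)⟩

lemma isPolyhedral_transposeImage (hX : IsPolyhedron X) :
    IsPolyhedral (transposeImage A X) :=
  (isPolyhedral_iff_isPolyhedron.2 hX).image
    (LinearMap.pi fun α : A => dotProductBilin ℝ ℝ (α : Fin n → ℝ))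

lemma exists_minimizes (hX : IsPolyhedron X) (hne : X.Nonempty)
    (h : SupportFinite X (-applyExponents A ν)) :
    ∃ y, Minimizes (transposeImage A X) y ν := by
  rw [SupportFinite, image_support_eq] at h
  obtain ⟨r, hr⟩ := h
  exact (isPolyhedral_transposeImage hX).exists_isMinOn (hne.image _) ν
    ⟨-r, by rintro _ ⟨y, hy, rfl⟩; exact neg_le.1 (hr ⟨y, hy, rfl⟩)⟩

lemma Minimizes.combo {Y : Set (A → ℝ)} (h₁ : Minimizes Y y ν₁) (h₂ : Minimizes Y y ν₂)
    {s t : ℝ} (hs : 0 ≤ s) (ht : 0 ≤ t) : Minimizes Y y (s • ν₁ + t • ν₂) :=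
  ⟨h₁.1, fun y' hy' => by
    simp only [add_dotProduct, smul_dotProduct, smul_eq_mul]
    exact add_le_add (mul_le_mul_of_nonneg_left (h₁.2 y' hy') hs)
      (mul_le_mul_of_nonneg_left (h₂.2 y' hy') ht)⟩

/-- The support function is linear on a segment as soon as one point is optimal for both ends. -/
lemma Minimizes.linearOnSegment (h₁ : Minimizes (transposeImage A X) y ν₁)
    (h₂ : Minimizes (transposeImage A X) y ν₂) : LinearOnSegment X A ν₁ ν₂ := by
  refine ⟨h₁.supportFinite, h₂.supportFinite, fun t ht => ?_⟩
  rw [h₁.supportFun_eq, h₂.supportFun_eq,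
    (h₁.combo h₂ (sub_nonneg.2 ht.2) ht.1).supportFun_eq]
  simp only [add_dotProduct, smul_dotProduct, smul_eq_mul]
  ring

/-- If the support function is linear on a segment, then a point which is optimal for an interior
point of the segment is optimal for both ends. -/
lemma minimizes_of_linearOnSegment (h : LinearOnSegment X A ν₁ ν₂) (hν : ν ∈ openSegment ℝ ν₁ ν₂)
    (hy : Minimizes (transposeImage A X) y ν) :
    Minimizes (transposeImage A X) y ν₁ ∧ Minimizes (transposeImage A X) y ν₂ := by
  obtain ⟨h₁, h₂, hlin⟩ := h
  obtain ⟨s, t, hs, ht, hst, rfl⟩ := hν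
  obtain rfl : s = 1 - t := by linarith
  have key := hlin t ⟨ht.le, by linarith⟩
  rw [hy.supportFun_eq] at key
  simp only [add_dotProduct, smul_dotProduct, smul_eq_mul] at key
  have l₁ := neg_dotProduct_le_supportFun h₁ hy.1
  have l₂ := neg_dotProduct_le_supportFun h₂ hy.1
  constructor
  · refine minimizes_of_supportFun_le h₁ hy.1 (le_of_mul_le_mul_left ?_ hs)
    linarith [mul_le_mul_of_nonneg_left l₂ ht.le]
  · refine minimizes_of_supportFun_le h₂ hy.1 (le_of_mul_le_mul_left ?_ ht)
    linarith [mul_le_mul_of_nonneg_left l₁ hs.le]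

lemma coneN_combo (h₁ : ν₁ ∈ coneN A β) (h₂ : ν₂ ∈ coneN A β) {s t : ℝ} (hs : 0 ≤ s)
    (ht : 0 ≤ t) : s • ν₁ + t • ν₂ ∈ coneN A β := by
  refine ⟨fun α hα => ?_, ?_⟩
  · exact add_nonneg (mul_nonneg hs (h₁.1 α hα)) (mul_nonneg ht (h₂.1 α hα))
  · simp [-Finset.univ_eq_attach, Finset.sum_add_distrib, ← Finset.mul_sum, h₁.2, h₂.2]

lemma smul_mem_coneN (h : ν ∈ coneN A β) {s : ℝ} (hs : 0 ≤ s) : s • ν ∈ coneN A β := by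
  simpa using coneN_combo h h hs le_rfl

lemma sum_erase_eq_neg (h : ν ∈ coneN A β) : ∑ α ∈ Finset.univ.erase β, ν α = -ν β := by
  linarith [Finset.add_sum_erase Finset.univ ν (Finset.mem_univ β), h.2]

lemma coneN_apply_neg (h : ν ∈ coneN A β) (h0 : ν ≠ 0) : ν β < 0 := by
  by_contra! hβ
  have hnn : ∀ α ∈ Finset.univ, 0 ≤ ν α := fun α _ => by
    by_cases hα : α = β
    · exact hα ▸ hβ
    · exact h.1 α hα
  exact h0 (funext fun α => (Finset.sum_eq_zero_iff_of_nonneg hnn).1 h.2 α (Finset.mem_univ α))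

/-- Two distinct normalized vectors with a common minimizer cannot enclose a circuit. -/
lemma eq_of_mem_openSegment (hν : IsCircuit X A β ν) (h₁ : ν₁ ∈ coneN A β) (h₂ : ν₂ ∈ coneN A β)
    (n₁ : ν₁ β = -1) (n₂ : ν₂ β = -1) (m₁ : Minimizes (transposeImage A X) y ν₁)
    (m₂ : Minimizes (transposeImage A X) y ν₂) (hmem : ν ∈ openSegment ℝ ν₁ ν₂) : ν₁ = ν₂ := by
  by_contra hne
  refine hν.2.2.2 ⟨ν₁, h₁, ν₂, h₂, ?_, m₁.linearOnSegment m₂, hmem⟩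
  rw [LinearIndependent.pair_iff]
  intro s t hst
  have hβ := congrFun hst β
  simp only [Pi.add_apply, Pi.smul_apply, n₁, n₂, smul_eq_mul, Pi.zero_apply] at hβ
  obtain rfl : t = -s := by linarith
  rw [neg_smul, ← sub_eq_add_neg, ← smul_sub] at hst
  have hs : s = 0 := (smul_eq_zero.1 hst).resolve_right (sub_ne_zero.2 hne)
  simp [hs]

/-- The normalized vectors for which `y` is a minimizer over `Y`. On this compact convex set the
support function is linear, and its extreme points are circuits. -/
def linearityCell (Y : Set (A → ℝ)) (β : A) (y : A → ℝ) : Set (A → ℝ) :=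
  {ν | ν ∈ coneN A β ∧ ν β = -1 ∧ ∀ y' ∈ Y, ν ⬝ᵥ y ≤ ν ⬝ᵥ y'}

lemma isCircuit_of_mem_extremePoints (hy : y ∈ transposeImage A X)
    (h : ν ∈ (linearityCell (transposeImage A X) β y).extremePoints ℝ) :
    ν ∈ normalizedCircuits X A β := by
  obtain ⟨⟨hN, hβ, hmin⟩, hext⟩ := h
  have hm : Minimizes (transposeImage A X) y ν := ⟨hy, hmin⟩
  refine ⟨⟨hN, fun h0 => by simp [h0] at hβ, hm.supportFinite, ?_⟩, hβ⟩
  rintro ⟨ν₁, h₁, ν₂, h₂, hli, hlin, hmem⟩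
  obtain ⟨m₁, m₂⟩ := minimizes_of_linearOnSegment hlin hmem hm
  have p₁ := coneN_apply_neg h₁ (hli.ne_zero 0)
  have p₂ := coneN_apply_neg h₂ (hli.ne_zero 1)
  have hcell : ∀ {μ : A → ℝ}, μ ∈ coneN A β → μ β < 0 → Minimizes (transposeImage A X) y μ →
      (-μ β)⁻¹ • μ ∈ linearityCell (transposeImage A X) β y := fun {μ} hμ hμβ mμ => by
    have hpos : 0 ≤ (-μ β)⁻¹ := inv_nonneg.2 (by linarith)
    refine ⟨smul_mem_coneN hμ hpos, ?_, ?_⟩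
    · have : μ β ≠ 0 := hμβ.ne
      simp only [Pi.smul_apply, smul_eq_mul]
      field_simp
    · simpa using (mμ.combo mμ hpos le_rfl).2
  obtain ⟨s, t, hs, ht, hst, rfl⟩ := hmem
  simp only [Pi.add_apply, Pi.smul_apply, smul_eq_mul] at hβ
  have hopen : s • ν₁ + t • ν₂ ∈ openSegment ℝ ((-ν₁ β)⁻¹ • ν₁) ((-ν₂ β)⁻¹ • ν₂) := by
    refine ⟨s * (-ν₁ β), t * (-ν₂ β), mul_pos hs (by linarith), mul_pos ht (by linarith),
      by linarith, ?_⟩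
    rw [smul_smul, smul_smul, mul_inv_cancel_right₀ (by linarith),
      mul_inv_cancel_right₀ (by linarith)]
  have e₁ := hext (hcell h₁ p₁ m₁) (hcell h₂ p₂ m₂) hopen
  have e₂ := hext (hcell h₂ p₂ m₂) (hcell h₁ p₁ m₁) (by rwa [openSegment_symm])
  have := (LinearIndependent.pair_iff.1 hli) (-ν₁ β)⁻¹ (-(-ν₂ β)⁻¹) (by
    rw [e₁, neg_smul, e₂, add_neg_cancel])
  exact inv_ne_zero (by linarith) this.1

lemma convex_linearityCell (Y : Set (A → ℝ)) (β : A) (y : A → ℝ) :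
    Convex ℝ (linearityCell Y β y) := by
  rintro ν₁ ⟨h₁, n₁, m₁⟩ ν₂ ⟨h₂, n₂, m₂⟩ s t hs ht hst
  refine ⟨coneN_combo h₁ h₂ hs ht, ?_, fun y' hy' => ?_⟩
  · simp only [Pi.add_apply, Pi.smul_apply, n₁, n₂, smul_eq_mul]
    linarith
  · simp only [add_dotProduct, smul_dotProduct, smul_eq_mul]
    exact add_le_add (mul_le_mul_of_nonneg_left (m₁ y' hy') hs)
      (mul_le_mul_of_nonneg_left (m₂ y' hy') ht)

lemma isCompact_linearityCell (Y : Set (A → ℝ)) (β : A) (y : A → ℝ) :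
    IsCompact (linearityCell Y β y) := by
  refine (isCompact_Icc (a := (-1 : A → ℝ)) (b := 1)).of_isClosed_subset ?_ ?_
  · simp only [linearityCell, coneN, Set.ofPred_and, Set.ofPred_forall]
    refine IsClosed.inter (IsClosed.inter ?_ ?_) (IsClosed.inter ?_ ?_)
    · exact isClosed_iInter fun α => isClosed_iInter fun _ =>
        isClosed_le continuous_const (continuous_apply α)
    · exact isClosed_eq (by fun_prop) continuous_const
    · exact isClosed_eq (continuous_apply β) continuous_const
    · exact isClosed_iInter fun y' => isClosed_iInter fun _ =>
        isClosed_le (by fun_prop) (by fun_prop)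
  · rintro ν ⟨hN, hβ, -⟩
    have hle : ∀ α, α ≠ β → ν α ≤ 1 := fun α hα => by
      have h := Finset.single_le_sum (f := ν) (s := Finset.univ.erase β)
        (fun i hi => hN.1 i (Finset.ne_of_mem_erase hi))
        (Finset.mem_erase.2 ⟨hα, Finset.mem_univ α⟩)
      rw [sum_erase_eq_neg hN, hβ] at h
      linarith
    constructor <;> intro α <;> by_cases hα : α = β
    · simp [hα, hβ]
    · exact le_trans (by simp) (hN.1 α hα)
    · simp only [hα, hβ, Pi.one_apply]; norm_num
    · exact hle α hα

/-- Nonnegative multipliers supported on the rows active at `y` certify that `y` is a minimizer. -/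
lemma minimizes_of_multipliers {J : Type*} [Fintype J] {M : Matrix J A ℝ} {b : J → ℝ}
    {z : J → ℝ} (hy : M *ᵥ y ≤ b) (hz : 0 ≤ z) (hact : ∀ j, z j ≠ 0 → (M *ᵥ y) j = b j)
    (hν : -ν = z ᵥ* M) : Minimizes {y | M *ᵥ y ≤ b} y ν := by
  refine ⟨hy, fun y' hy' => neg_le_neg_iff.1 ?_⟩
  rw [← neg_dotProduct, ← neg_dotProduct, hν, ← Matrix.dotProduct_mulVec,
    ← Matrix.dotProduct_mulVec]
  refine Finset.sum_le_sum fun j _ => ?_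
  by_cases h : z j = 0
  · simp [h]
  · rw [hact j h]
    exact mul_le_mul_of_nonneg_left (hy' j) (hz j)

lemma eventually_nonneg_add_mul {a d : ℝ} (ha : 0 ≤ a) (h : a = 0 → d = 0) :
    ∀ᶠ ε in nhds (0 : ℝ), 0 ≤ a + ε * d := by
  rcases ha.eq_or_lt with h0 | h0
  · simp [← h0, h h0.symm]
  · have hc : ContinuousAt (fun ε : ℝ => a + ε * d) 0 := by fun_prop
    exact (continuousAt_const.eventually_lt hc (by simpa using h0)).mono fun _ h => h.le

/-- A normalized circuit is determined by its support and the support of its multipliers: it is the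
only solution of the corresponding linear system. Otherwise one could move from the circuit along
the line through a second solution, in both directions, with a fixed minimizer. -/
lemma eq_circuit_of_support {J : Type*} [Fintype J] {M : Matrix J A ℝ} {b : J → ℝ}
    (hM : transposeImage A X = {y | M *ᵥ y ≤ b}) (hν : ν ∈ normalizedCircuits X A β)
    {z : J → ℝ} (hy : M *ᵥ y ≤ b) (hz : 0 ≤ z) (hact : ∀ j, z j ≠ 0 → (M *ᵥ y) j = b j)
    (hνz : -ν = z ᵥ* M) {ν' : A → ℝ} {z' : J → ℝ} (hν'z : -ν' = z' ᵥ* M) (hβ' : ν' β = -1)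
    (hsum : ∑ α, ν' α = 0) (hsupp : ∀ α, ν α = 0 → ν' α = 0) (hsuppz : ∀ j, z j = 0 → z' j = 0) :
    ν' = ν := by
  obtain ⟨hc, hβ⟩ := hν
  let g : ℝ → A → ℝ := fun ε => ν + ε • (ν' - ν)
  have hev : ∀ᶠ ε in nhds (0 : ℝ), (∀ α, α ≠ β → 0 ≤ ν α + ε * (ν' α - ν α)) ∧
      ∀ j, 0 ≤ z j + ε * (z' j - z j) := by
    refine Filter.Eventually.and (Filter.eventually_all.2 fun α => ?_)
      (Filter.eventually_all.2 fun j => eventually_nonneg_add_mul (hz j) fun h => by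
        rw [h, hsuppz j h, sub_zero])
    by_cases hα : α = β
    · exact Filter.Eventually.of_forall fun _ h => absurd hα h
    · exact (eventually_nonneg_add_mul (hc.1.1 α hα) fun h => by
        rw [h, hsupp α h, sub_zero]).mono fun _ h _ => h
  have hg : ∀ ε, ((∀ α, α ≠ β → 0 ≤ ν α + ε * (ν' α - ν α)) ∧
      ∀ j, 0 ≤ z j + ε * (z' j - z j)) →
      g ε ∈ coneN A β ∧ g ε β = -1 ∧ Minimizes (transposeImage A X) y (g ε) := fun ε h => by
    refine ⟨⟨fun α hα => h.1 α hα, ?_⟩, ?_, ?_⟩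
    · simp [-Finset.univ_eq_attach, g, Finset.sum_add_distrib, ← Finset.mul_sum, hc.1.2, hsum]
    · simp [g, hβ, hβ']
    · rw [hM]
      refine minimizes_of_multipliers (z := z + ε • (z' - z)) hy h.2 (fun j hj => hact j ?_) ?_
      · intro h0
        simp [h0, hsuppz j h0] at hj
      · simp only [g, neg_add, Matrix.add_vecMul, Matrix.smul_vecMul, Matrix.sub_vecMul, ← hνz,
          ← hν'z, ← smul_neg]
        congr 2
        abel
  have hneg : ∀ᶠ ε in nhds (0 : ℝ), (∀ α, α ≠ β → 0 ≤ ν α + -ε * (ν' α - ν α)) ∧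
      ∀ j, 0 ≤ z j + -ε * (z' j - z j) :=
    (show Filter.Tendsto (fun ε : ℝ => -ε) (nhds 0) (nhds 0) by
      simpa using (continuous_neg.tendsto (0 : ℝ))).eventually hev
  obtain ⟨ε, ⟨h₁, h₂⟩, hε⟩ := (((hev.and hneg).filter_mono nhdsWithin_le_nhds).and
    (self_mem_nhdsWithin (a := (0 : ℝ)) (s := Set.Ioi 0))).exists
  have hε : 0 < ε := hε
  obtain ⟨c₁, n₁, m₁⟩ := hg _ h₁
  obtain ⟨c₂, n₂, m₂⟩ := hg _ h₂
  have heq := eq_of_mem_openSegment hc c₁ c₂ n₁ n₂ m₁ m₂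
    ⟨1 / 2, 1 / 2, by norm_num, by norm_num, by norm_num, by
      ext α; simp only [g, Pi.add_apply, Pi.smul_apply, Pi.sub_apply, smul_eq_mul]; ring⟩
  ext α
  have := congrFun heq α
  simp only [g, Pi.add_apply, Pi.smul_apply, Pi.sub_apply, smul_eq_mul] at this
  have : ε * (ν' α - ν α) = 0 := by linarith
  linarith [(mul_eq_zero.1 this).resolve_left hε.ne']

lemma exists_circuit_multipliers (hX : IsPolyhedron X) (hne : X.Nonempty) {J : Type*} [Fintype J]
    {M : Matrix J A ℝ} {b : J → ℝ} (hM : transposeImage A X = {y | M *ᵥ y ≤ b})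
    (hν : ν ∈ normalizedCircuits X A β) :
    ∃ y z, M *ᵥ y ≤ b ∧ 0 ≤ z ∧ (∀ j, z j ≠ 0 → (M *ᵥ y) j = b j) ∧ -ν = z ᵥ* M := by
  obtain ⟨y, hy⟩ := exists_minimizes hX hne hν.1.2.2.1
  rw [hM] at hy
  obtain ⟨z, hz⟩ := exists_multipliers M b ν y hy.1 hy.2
  exact ⟨y, z, hy.1, hz⟩

lemma finite_normalizedCircuits (hX : IsPolyhedron X) (hne : X.Nonempty) (β : A) :
    (normalizedCircuits X A β).Finite := by
  classical
  obtain ⟨m, M, b, hM⟩ := isPolyhedral_iff_isPolyhedron.1 (isPolyhedral_transposeImage (A := A) hX)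
  choose! y z hy hz hact hνz using
    fun ν (hν : ν ∈ normalizedCircuits X A β) => exists_circuit_multipliers hX hne hM hν
  refine Set.Finite.of_finite_image (f := fun ν => (Function.support ν, Function.support (z ν)))
    (Set.toFinite _) fun ν hν ν' hν' h => ?_
  obtain ⟨h₁, h₂⟩ := Prod.ext_iff.1 h
  refine (eq_circuit_of_support hM hν (hy ν hν) (hz ν hν) (hact ν hν) (hνz ν hν) (hνz ν' hν')
    hν'.2 hν'.1.1.2 (fun α hα => ?_) fun j hj => ?_).symm
  · by_contra h
    exact (h₁.symm.subset h : α ∈ Function.support ν) hα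
  · by_contra h
    exact (h₂.symm.subset h : j ∈ Function.support (z ν)) hj

/-- Circuits of rational polyhedra are rational. A `ℚ`-linear retraction of `ℝ` onto `ℚ` maps the
rational linear system which determines the circuit to itself, hence fixes the circuit. -/
lemma exists_rat_of_mem_normalizedCircuits (hX : IsPolyhedron X) (hne : X.Nonempty)
    (hrat : IsRationalPolyhedron (transposeImage A X)) (hν : ν ∈ normalizedCircuits X A β) :
    ∃ q : A → ℚ, ν = fun α => (q α : ℝ) := by
  obtain ⟨m, M, b, hM⟩ := hrat
  obtain ⟨y, z, hy, hz, hact, hνz⟩ := exists_circuit_multipliers hX hne hM hν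
  obtain ⟨π, hπ⟩ := (Algebra.linearMap ℚ ℝ).exists_leftInverse_of_injective
    (LinearMap.ker_eq_bot.2 (algebraMap ℚ ℝ).injective)
  have hπq : ∀ q : ℚ, π q = q := fun q => LinearMap.congr_fun hπ q
  have hmul : ∀ (r : ℝ) (q : ℚ), π (r * q) = π r * q := fun r q => by
    rw [mul_comm, ← Rat.smul_def, map_smul, smul_eq_mul, mul_comm]
  refine ⟨fun α => π (ν α), (eq_circuit_of_support hM hν hy hz hact hνz
    (z' := fun j => (π (z j) : ℝ)) ?_ ?_ ?_ ?_ ?_).symm⟩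
  · ext α
    have h := congrArg π (congrFun hνz α)
    simp only [Pi.neg_apply, map_neg, Matrix.vecMul, dotProduct, Matrix.map_apply, map_sum,
      hmul] at h ⊢
    exact_mod_cast congrArg (fun q : ℚ => (q : ℝ)) h
  · have := hπq (-1)
    simp only [hν.2]
    exact_mod_cast congrArg (fun q : ℚ => (q : ℝ)) this
  · have h := congrArg π hν.1.1.2
    rw [map_sum, map_zero] at h
    exact_mod_cast congrArg (fun q : ℚ => (q : ℝ)) h
  · intro α hα
    simp [hα]
  · intro j hj
    simp [hj]

/-- A normalized vector at which the support function is finite is a convex combination of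
normalized circuits which have a common minimizer, by the Krein–Milman theorem in its linearity
cell. -/
lemma exists_circuit_combination (hX : IsPolyhedron X) (hne : X.Nonempty) (hN : ν ∈ coneN A β)
    (hβ : ν β = -1) (hfin : SupportFinite X (-applyExponents A ν)) :
    ∃ (y : A → ℝ) (T : Finset (A → ℝ)) (w : (A → ℝ) → ℝ),
      (∀ l ∈ T, l ∈ normalizedCircuits X A β ∧ Minimizes (transposeImage A X) y l) ∧
      Minimizes (transposeImage A X) y ν ∧
      (∀ l ∈ T, 0 ≤ w l) ∧ ∑ l ∈ T, w l = 1 ∧ ∑ l ∈ T, w l • l = ν := by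
  obtain ⟨y, hy⟩ := exists_minimizes hX hne hfin
  let F := linearityCell (transposeImage A X) β y
  have hsub : F.extremePoints ℝ ⊆ normalizedCircuits X A β :=
    fun _ h => isCircuit_of_mem_extremePoints hy.1 h
  have hfinE : (F.extremePoints ℝ).Finite := (finite_normalizedCircuits hX hne β).subset hsub
  have hconv : convexHull ℝ (F.extremePoints ℝ) = F := by
    rw [← (hfinE.isClosed_convexHull ℝ).closure_eq]
    exact closure_convexHull_extremePoints (isCompact_linearityCell _ β y)
      (convex_linearityCell _ β y)
  have hmem : ν ∈ convexHull ℝ (hfinE.toFinset : Set (A → ℝ)) := by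
    rw [hfinE.coe_toFinset, hconv]
    exact ⟨hN, hβ, hy.2⟩
  obtain ⟨w, hw, hw1, hwν⟩ := Finset.mem_convexHull'.1 hmem
  refine ⟨y, hfinE.toFinset, w, fun l hl => ?_, hy, hw, hw1, hwν⟩
  have hl := hfinE.mem_toFinset.1 hl
  exact ⟨hsub hl, hy.1, (extremePoints_subset hl).2.2⟩

end Circuits

/-! ### Witnessed AGE cones -/

section Witnessed

variable {n : ℕ} {X : Set (Fin n → ℝ)} {A : Finset (Fin n → ℝ)} {β : A} {ν c : A → ℝ}

lemma IsPolyhedral.convex {E : Type*} [AddCommGroup E] [Module ℝ E] {S : Set E}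
    (hS : IsPolyhedral S) : Convex ℝ S := by
  obtain ⟨J, _, f, b, rfl⟩ := hS
  rw [Set.ofPred_forall]
  exact convex_iInter fun j => convex_halfSpace_le (f j).isLinear (b j)

lemma filter_pos_subset_erase (hβ : ν β = -1) :
    Finset.univ.filter (fun α => 0 < ν α) ⊆ Finset.univ.erase β := fun α hα => by
  refine Finset.mem_erase.2 ⟨?_, Finset.mem_univ α⟩
  rintro rfl
  linarith [(Finset.mem_filter.1 hα).2]

lemma eq_zero_of_notMem_filter_pos (hN : ν ∈ coneN A β) {α : A} (hα : α ∈ Finset.univ.erase β)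
    (h : α ∉ Finset.univ.filter fun α => 0 < ν α) : ν α = 0 :=
  le_antisymm (not_lt.1 fun hlt => h (Finset.mem_filter.2 ⟨Finset.mem_univ α, hlt⟩))
    (hN.1 α (Finset.ne_of_mem_erase hα))

/-- A sum weighted by the positive entries of a normalized `ν ∈ coneN A β`. -/
lemma sum_filter_pos_mul (hN : ν ∈ coneN A β) (hβ : ν β = -1) (f : A → ℝ) :
    ∑ α with 0 < ν α, ν α * f α = ν ⬝ᵥ f + f β := by
  rw [Finset.sum_subset (filter_pos_subset_erase hβ) fun α hα h => by
    rw [eq_zero_of_notMem_filter_pos hN hα h, zero_mul]]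
  have := Finset.add_sum_erase Finset.univ (fun α => ν α * f α) (Finset.mem_univ β)
  simp only [hβ] at this
  rw [dotProduct, ← this]
  ring

lemma sum_filter_pos (hN : ν ∈ coneN A β) (hβ : ν β = -1) : ∑ α with 0 < ν α, ν α = 1 := by
  have := sum_filter_pos_mul hN hβ 1
  simpa [-Finset.univ_eq_attach, dotProduct_one, hN.2] using this

lemma prod_filter_pos_rpow (hN : ν ∈ coneN A β) (hβ : ν β = -1) (f : A → ℝ) :
    ∏ α with 0 < ν α, f α ^ ν α = ∏ α ∈ Finset.univ.erase β, f α ^ ν α :=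
  Finset.prod_subset (filter_pos_subset_erase hβ) fun α hα h => by
    rw [eq_zero_of_notMem_filter_pos hN hα h, Real.rpow_zero]

lemma prod_div_rpow_nonneg (hβ : ν β = -1) (hc : ∀ α, α ≠ β → 0 ≤ c α) :
    0 ≤ ∏ α with 0 < ν α, (c α / ν α) ^ ν α :=
  Finset.prod_nonneg fun α hα => Real.rpow_nonneg
    (div_nonneg (hc α (Finset.ne_of_mem_erase (filter_pos_subset_erase hβ hα)))
      (Finset.mem_filter.1 hα).2.le) _

lemma signomial_eq (c : A → ℝ) (β : A) (x : Fin n → ℝ) :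
    signomial A c x = c β * Real.exp ((β : Fin n → ℝ) ⬝ᵥ x) +
      ∑ α ∈ Finset.univ.erase β, c α * Real.exp ((α : Fin n → ℝ) ⬝ᵥ x) :=
  (Finset.add_sum_erase Finset.univ
    (fun α : A => c α * Real.exp ((α : Fin n → ℝ) ⬝ᵥ x)) (Finset.mem_univ β)).symm

/-- Witnessed cones consist of AGE signomials, by the weighted inequality between the arithmetic
and the geometric mean. -/
lemma witnessedCone_subset_ageCone (hN : ν ∈ coneN A β) (hβ : ν β = -1)
    (hfin : SupportFinite X (-applyExponents A ν)) :
    witnessedCone X A β ν ⊆ ageCone X A β := by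
  rintro c ⟨hc, hw⟩
  refine ⟨hc, fun x hx => ?_⟩
  let y : A → ℝ := fun α => (α : Fin n → ℝ) ⬝ᵥ x
  let P := ∏ α with 0 < ν α, (c α / ν α) ^ ν α
  have hne : ∀ α ∈ Finset.univ.filter (fun α => 0 < ν α), α ≠ β := fun α hα =>
    Finset.ne_of_mem_erase (filter_pos_subset_erase hβ hα)
  have hpos : ∀ α ∈ Finset.univ.filter (fun α => 0 < ν α), 0 < ν α := fun α hα =>
    (Finset.mem_filter.1 hα).2
  have hdiv : ∀ α ∈ Finset.univ.filter (fun α => 0 < ν α), 0 ≤ c α / ν α := fun α hα =>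
    div_nonneg (hc α (hne α hα)) (hpos α hα).le
  have amgm := Real.geom_mean_le_arith_mean_weighted (Finset.univ.filter fun α => 0 < ν α) ν
    (fun α => c α / ν α * Real.exp (y α - y β)) (fun α hα => (hpos α hα).le)
    (sum_filter_pos hN hβ) fun α hα => mul_nonneg (hdiv α hα) (Real.exp_pos _).le
  have hprod : ∏ α with 0 < ν α, (c α / ν α * Real.exp (y α - y β)) ^ ν α =
      P * Real.exp (ν ⬝ᵥ y) := by
    rw [Finset.prod_congr rfl fun α hα => Real.mul_rpow (hdiv α hα) (Real.exp_pos _).le,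
      Finset.prod_mul_distrib]
    congr 1
    simp only [← Real.exp_mul, ← Real.exp_sum]
    congr 1
    have := sum_filter_pos_mul hN hβ fun α => y α - y β
    simp only [sub_self, add_zero] at this
    rw [Finset.sum_congr rfl fun α _ => mul_comm _ _, this, dotProduct, dotProduct]
    simp only [mul_sub, Finset.sum_sub_distrib, ← Finset.sum_mul, hN.2, zero_mul, sub_zero]
  have hsum : ∑ α with 0 < ν α, ν α * (c α / ν α * Real.exp (y α - y β)) ≤
      ∑ α ∈ Finset.univ.erase β, c α * Real.exp (y α - y β) := by
    rw [Finset.sum_congr rfl fun α hα => show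
      ν α * (c α / ν α * Real.exp (y α - y β)) = c α * Real.exp (y α - y β) by
        rw [← mul_assoc, mul_div_cancel₀ _ (hpos α hα).ne']]
    exact Finset.sum_le_sum_of_subset_of_nonneg (filter_pos_subset_erase hβ) fun α hα _ =>
      mul_nonneg (hc α (Finset.ne_of_mem_erase hα)) (Real.exp_pos _).le
  have hσ := neg_dotProduct_le_supportFun hfin (Set.mem_image_of_mem _ hx)
  have hP : -c β ≤ P * Real.exp (ν ⬝ᵥ y) := by
    have h1 : -c β * Real.exp (supportFun X (-applyExponents A ν)) *
        Real.exp (-supportFun X (-applyExponents A ν)) ≤ P * Real.exp (ν ⬝ᵥ y) :=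
      (mul_le_mul_of_nonneg_right hw (Real.exp_pos _).le).trans
        (mul_le_mul_of_nonneg_left (Real.exp_le_exp.2 (by linarith))
          (prod_div_rpow_nonneg hβ hc))
    rwa [mul_assoc, ← Real.exp_add, add_neg_cancel, Real.exp_zero, mul_one] at h1
  rw [hprod] at amgm
  have hfinal := mul_le_mul_of_nonneg_right (hP.trans (amgm.trans hsum)) (Real.exp_pos (y β)).le
  rw [Finset.sum_mul, Finset.sum_congr rfl fun α _ => show
    c α * Real.exp (y α - y β) * Real.exp (y β) = c α * Real.exp (y α) by
      rw [mul_assoc, ← Real.exp_add, sub_add_cancel]] at hfinal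
  rw [signomial_eq c β]
  linarith

/-- The exponent vectors at which the negative term of an AGE signomial dominates; AGE signomials
are those for which this open convex set avoids `transposeImage A X`. -/
def dominatedSet (c : A → ℝ) (β : A) : Set (A → ℝ) :=
  {s | ∑ α ∈ Finset.univ.erase β, c α * Real.exp (s α - s β) < -c β}

lemma convex_dominatedSet (hc : ∀ α, α ≠ β → 0 ≤ c α) : Convex ℝ (dominatedSet c β) := by
  have h : ConvexOn ℝ Set.univ
      (fun s : A → ℝ => ∑ α ∈ Finset.univ.erase β, c α * Real.exp (s α - s β)) := by
    have : ∀ t ⊆ Finset.univ.erase β, ConvexOn ℝ Set.univ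
        (fun s : A → ℝ => ∑ α ∈ t, c α * Real.exp (s α - s β)) := by
      intro t
      induction t using Finset.induction_on with
      | empty => intro _; simpa using convexOn_const (0 : ℝ) convex_univ
      | insert α t hα ih =>
        intro ht
        simp only [Finset.sum_insert hα]
        refine ConvexOn.add ?_ (ih fun i hi => ht (Finset.mem_insert_of_mem hi))
        have hexp : ConvexOn ℝ Set.univ (fun s : A → ℝ => Real.exp (s α - s β)) := by
          refine ⟨convex_univ, fun s _ t _ a b ha hb hab => ?_⟩
          convert convexOn_exp.2 (Set.mem_univ (s α - s β)) (Set.mem_univ (t α - t β)) ha hb hab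
            using 2
          simp only [Pi.add_apply, Pi.smul_apply, smul_eq_mul]
          ring
        exact hexp.smul (hc α (Finset.ne_of_mem_erase (ht (Finset.mem_insert_self α t))))
    exact this _ subset_rfl
  simpa [dominatedSet] using h.convex_lt (-c β)

lemma isOpen_dominatedSet : IsOpen (dominatedSet c β) :=
  isOpen_lt (by fun_prop) continuous_const

/-- Recession directions of `dominatedSet`. -/
lemma add_smul_mem_dominatedSet (hc : ∀ α, α ≠ β → 0 ≤ c α) {s d : A → ℝ}
    (hs : s ∈ dominatedSet c β) (hd : ∀ α, α ≠ β → c α = 0 ∨ d α ≤ d β) {t : ℝ} (ht : 0 ≤ t) :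
    s + t • d ∈ dominatedSet c β := by
  refine lt_of_le_of_lt (Finset.sum_le_sum fun α hα => ?_)
    (show ∑ α ∈ Finset.univ.erase β, c α * Real.exp (s α - s β) < -c β from hs)
  have hα := Finset.ne_of_mem_erase hα
  rcases hd α hα with h | h
  · simp [h]
  · refine mul_le_mul_of_nonneg_left (Real.exp_le_exp.2 ?_) (hc α hα)
    simp only [Pi.add_apply, Pi.smul_apply, smul_eq_mul]
    linarith [mul_le_mul_of_nonneg_left h ht]

lemma nonempty_dominatedSet (hcβ : c β < 0) : (dominatedSet c β).Nonempty := by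
  classical
  have h : Filter.Tendsto (fun t : ℝ => ∑ α ∈ Finset.univ.erase β, c α * Real.exp (-t))
      Filter.atTop (nhds (∑ α ∈ Finset.univ.erase β, c α * 0)) :=
    tendsto_finsetSum _ fun α _ =>
      (Real.tendsto_exp_neg_atTop_nhds_zero).const_mul _
  simp only [mul_zero, Finset.sum_const_zero] at h
  obtain ⟨t, ht⟩ := (h.eventually_lt_const (u := -c β) (by linarith)).exists
  refine ⟨Pi.single β t, lt_of_le_of_lt (le_of_eq (Finset.sum_congr rfl fun α hα => ?_)) ht⟩
  simp [Finset.ne_of_mem_erase hα]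

/-- The supremum over `dominatedSet` of a linear functional `ν`. It is approached at the points
where the terms of the signomial at `α` are proportional to `ν α`. -/
lemma le_of_forall_dominatedSet (hN : ν ∈ coneN A β) (hβ : ν β = -1)
    (hc : ∀ α, α ≠ β → 0 ≤ c α) (hcβ : c β < 0) (hν : ∀ α, 0 < ν α → 0 < c α) {r : ℝ}
    (hr : ∀ s ∈ dominatedSet c β, ν ⬝ᵥ s ≤ r) :
    Real.log (-c β) - ∑ α with 0 < ν α, ν α * Real.log (c α / ν α) ≤ r := by
  classical
  refine le_of_forall_pos_sub_le fun ε hε => ?_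
  let C := ∑ α ∈ Finset.univ.erase β, c α
  have hC : 0 ≤ C := Finset.sum_nonneg fun α hα => hc α (Finset.ne_of_mem_erase hα)
  have hε1 : Real.exp (-ε) < 1 := Real.exp_lt_one_iff.2 (by linarith)
  -- the size of the terms with `ν α = 0`, which do not contribute to `ν ⬝ᵥ s`
  let δ := (1 - Real.exp (-ε)) * (-c β) / (C + 1)
  have hδ : 0 < δ := div_pos (mul_pos (by linarith) (by linarith)) (by linarith)
  let s : A → ℝ := fun α => if α = β then 0 else
    if 0 < ν α then Real.log (-c β) - Real.log (c α / ν α) - ε else Real.log δ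
  have hsβ : s β = 0 := if_pos rfl
  have hspos : ∀ α, 0 < ν α → s α = Real.log (-c β) - Real.log (c α / ν α) - ε := fun α hα => by
    have : α ≠ β := by rintro rfl; linarith
    simp [s, this, hα]
  have hs : s ∈ dominatedSet c β := by
    have hle : ∀ α ∈ Finset.univ.erase β, c α * Real.exp (s α - s β) ≤
        Real.exp (-ε) * (-c β) * ν α + δ * c α := fun α hα => by
      have hα := Finset.ne_of_mem_erase hα
      rw [hsβ, sub_zero]
      by_cases hp : 0 < ν α
      · have hcα := hν α hp
        rw [hspos α hp, sub_sub, add_comm, ← sub_sub, Real.exp_sub,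
          Real.exp_log (div_pos hcα hp), sub_eq_neg_add, Real.exp_add,
          Real.exp_log (by linarith : 0 < -c β)]
        have : c α * (Real.exp (-ε) * -c β / (c α / ν α)) = Real.exp (-ε) * (-c β) * ν α := by
          field_simp
        rw [this]
        linarith [mul_pos hδ hcα]
      · have h0 : ν α = 0 := le_antisymm (not_lt.1 hp) (hN.1 α hα)
        have hsα : s α = Real.log δ := by simp only [s, if_neg hα, if_neg hp]
        rw [hsα, h0, Real.exp_log hδ, mul_zero, zero_add]
        exact (mul_comm _ _).le
    refine lt_of_le_of_lt (Finset.sum_le_sum hle) ?_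
    rw [Finset.sum_add_distrib, ← Finset.mul_sum, ← Finset.mul_sum, sum_erase_eq_neg hN, hβ]
    have : δ * C < δ * (C + 1) := mul_lt_mul_of_pos_left (by linarith) hδ
    rw [div_mul_cancel₀ _ (by linarith : C + 1 ≠ 0)] at this
    linarith
  have key := hr s hs
  have h1 := sum_filter_pos_mul hN hβ s
  rw [hsβ, add_zero] at h1
  rw [← h1, Finset.sum_congr rfl fun α hα => by
    rw [hspos α (Finset.mem_filter.1 hα).2]] at key
  simp only [mul_sub, Finset.sum_sub_distrib, ← Finset.sum_mul, sum_filter_pos hN hβ,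
    one_mul] at key
  linarith

/-- An AGE signomial with a negative coefficient has a witness. Separating `dominatedSet` from the
polyhedron `transposeImage A X` yields the witness. -/
lemma exists_witness (hX : IsPolyhedron X) (hne : X.Nonempty) (hc : c ∈ ageCone X A β)
    (hcβ : c β < 0) :
    ∃ ν ∈ coneN A β, ν β = -1 ∧ SupportFinite X (-applyExponents A ν) ∧
      c ∈ witnessedCone X A β ν := by
  classical
  obtain ⟨hc, hnn⟩ := hc
  have hdisj : Disjoint (dominatedSet c β) (transposeImage A X) := by
    rw [Set.disjoint_left]
    rintro _ hs ⟨x, hx, rfl⟩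
    have h := hnn x hx
    rw [signomial_eq c β] at h
    have hs := mul_lt_mul_of_pos_right (show _ < -c β from hs)
      (Real.exp_pos ((β : Fin n → ℝ) ⬝ᵥ x))
    rw [Finset.sum_mul, Finset.sum_congr rfl fun α _ => by
      rw [mul_assoc, ← Real.exp_add, sub_add_cancel]] at hs
    linarith
  obtain ⟨φ, r, hφ, hr⟩ := geometric_hahn_banach_open (convex_dominatedSet hc) isOpen_dominatedSet
    (isPolyhedral_transposeImage hX).convex hdisj
  obtain ⟨μ, hμ⟩ := exists_eq_dotProduct (φ : (A → ℝ) →ₗ[ℝ] ℝ)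
  have hφ' : ∀ s ∈ dominatedSet c β, μ ⬝ᵥ s < r := fun s hs => by
    rw [← hμ]; exact hφ s hs
  have hr' : ∀ y ∈ transposeImage A X, r ≤ μ ⬝ᵥ y := fun y hy => by
    rw [← hμ]; exact hr y hy
  obtain ⟨s₀, hs₀⟩ := nonempty_dominatedSet (c := c) hcβ
  have hrec : ∀ d : A → ℝ, (∀ α, α ≠ β → c α = 0 ∨ d α ≤ d β) → μ ⬝ᵥ d ≤ 0 := fun d hd => by
    by_contra! hpos
    have hlt := hφ' s₀ hs₀
    have := hφ' _ (add_smul_mem_dominatedSet hc hs₀ hd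
      (div_nonneg (sub_nonneg.2 hlt.le) hpos.le))
    rw [dotProduct_add, dotProduct_smul, smul_eq_mul, div_mul_cancel₀ _ hpos.ne'] at this
    linarith
  have hsum : ∑ α, μ α = 0 := by
    have h1 := hrec 1 fun α _ => Or.inr le_rfl
    have h2 := hrec (-1) fun α _ => Or.inr le_rfl
    rw [dotProduct_neg] at h2
    rw [← dotProduct_one]
    linarith
  have hμnn : ∀ α, α ≠ β → 0 ≤ μ α := fun α hα => by
    have := hrec (Pi.single α (-1)) fun γ _ => Or.inr (by
      rw [Pi.single_eq_of_ne hα.symm]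
      by_cases h : γ = α
      · subst h; simp
      · simp [h])
    rw [dotProduct_single] at this
    linarith
  have hμ0 : ∀ α, α ≠ β → c α = 0 → μ α ≤ 0 := fun α hα h0 => by
    have := hrec (Pi.single α 1) fun γ _ => by
      by_cases h : γ = α
      · exact Or.inl (h ▸ h0)
      · exact Or.inr (by simp [h, hα.symm])
    simpa [dotProduct_single] using this
  have hμN : μ ∈ coneN A β := ⟨hμnn, hsum⟩
  have hμne : μ ≠ 0 := by
    rintro rfl
    obtain ⟨y, hy⟩ : (transposeImage A X).Nonempty := hne.image _
    have h1 := hφ' s₀ hs₀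
    have h2 := hr' y hy
    rw [zero_dotProduct] at h1 h2
    linarith
  have hμβ := coneN_apply_neg hμN hμne
  have hkpos : 0 < (-μ β)⁻¹ := inv_pos.2 (by linarith)
  have hβ : ((-μ β)⁻¹ • μ) β = -1 := by
    have : μ β ≠ 0 := hμβ.ne
    simp only [Pi.smul_apply, smul_eq_mul]
    field_simp
  have hN : (-μ β)⁻¹ • μ ∈ coneN A β := smul_mem_coneN hμN hkpos.le
  have hbd : ∀ v ∈ (fun y => -(((-μ β)⁻¹ • μ) ⬝ᵥ y)) '' transposeImage A X,
      v ≤ -((-μ β)⁻¹ * r) := by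
    rintro _ ⟨y, hy, rfl⟩
    simp only [smul_dotProduct, smul_eq_mul]
    exact neg_le_neg (mul_le_mul_of_nonneg_left (hr' y hy) hkpos.le)
  have hσ : supportFun X (-applyExponents A ((-μ β)⁻¹ • μ)) ≤ -((-μ β)⁻¹ * r) := by
    rw [supportFun, image_support_eq]
    exact csSup_le ((hne.image _).image _) hbd
  have hνc : ∀ α, 0 < ((-μ β)⁻¹ • μ) α → 0 < c α := fun α hα => by
    have hne : α ≠ β := by rintro rfl; linarith
    refine lt_of_le_of_ne (hc α hne) fun h0 => ?_
    have := mul_nonpos_of_nonneg_of_nonpos hkpos.le (hμ0 α hne h0.symm)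
    exact absurd hα (not_lt.2 this)
  have hlog := le_of_forall_dominatedSet hN hβ hc hcβ hνc (r := (-μ β)⁻¹ * r) fun s hs => by
    rw [smul_dotProduct, smul_eq_mul]
    exact mul_le_mul_of_nonneg_left (hφ' s hs).le hkpos.le
  refine ⟨(-μ β)⁻¹ • μ, hN, hβ, ?_, hc, ?_⟩
  · rw [SupportFinite, image_support_eq]
    exact ⟨_, hbd⟩
  · set ν := (-μ β)⁻¹ • μ
    have hpos : ∀ α ∈ Finset.univ.filter (fun α => 0 < ν α), 0 < c α / ν α := fun α hα =>
      div_pos (hνc α (Finset.mem_filter.1 hα).2) (Finset.mem_filter.1 hα).2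
    rw [Finset.prod_congr rfl fun α hα => Real.rpow_def_of_pos (hpos α hα) (ν α),
      ← Real.exp_sum]
    nth_rw 1 [← Real.exp_log (by linarith : 0 < -c β)]
    rw [← Real.exp_add, Real.exp_le_exp, Finset.sum_congr rfl fun α _ => mul_comm _ _]
    linarith

lemma zero_mem_witnessedCone (hβ : ν β = -1) : (0 : A → ℝ) ∈ witnessedCone X A β ν :=
  ⟨fun _ _ => le_rfl, by
    simpa using prod_div_rpow_nonneg (ν := ν) (c := 0) hβ fun _ _ => le_rfl⟩

lemma add_mem_witnessedCone (hβ : ν β = -1) {d : A → ℝ} (hd : ∀ α, 0 ≤ d α)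
    (hc : c ∈ witnessedCone X A β ν) : d + c ∈ witnessedCone X A β ν := by
  refine ⟨fun α hα => add_nonneg (hd α) (hc.1 α hα), ?_⟩
  refine le_trans (mul_le_mul_of_nonneg_right ?_ (Real.exp_pos _).le)
    (hc.2.trans (Finset.prod_le_prod (fun α hα => ?_) fun α hα => ?_))
  · simp only [Pi.add_apply]
    linarith [hd β]
  · exact Real.rpow_nonneg (div_nonneg
      (hc.1 α (Finset.ne_of_mem_erase (filter_pos_subset_erase hβ hα)))
      (Finset.mem_filter.1 hα).2.le) _
  · have hp := (Finset.mem_filter.1 hα).2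
    refine Real.rpow_le_rpow (div_nonneg
      (hc.1 α (Finset.ne_of_mem_erase (filter_pos_subset_erase hβ hα))) hp.le) ?_ hp.le
    exact div_le_div_of_nonneg_right (by simp only [Pi.add_apply]; linarith [hd α]) hp.le

/-- A signomial with witness `∑ w l • l`, where the support function is linear on the vectors `l`,
splits into signomials with witnesses `l` and a nonnegative rest. The coefficients are
distributed in proportion to `w l * l α`; that the negative coefficients obtained in this way
suffice is the weighted inequality between the arithmetic and the geometric mean. -/
lemma exists_split (hN : ν ∈ coneN A β) (hβ : ν β = -1) {y : A → ℝ}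
    (hy : Minimizes (transposeImage A X) y ν) {T : Finset (A → ℝ)} {w : (A → ℝ) → ℝ}
    (hT : ∀ l ∈ T, l ∈ coneN A β ∧ l β = -1 ∧ Minimizes (transposeImage A X) y l)
    (hw : ∀ l ∈ T, 0 ≤ w l) (hw1 : ∑ l ∈ T, w l = 1) (hwν : ∑ l ∈ T, w l • l = ν)
    (hc : c ∈ witnessedCone X A β ν) :
    ∃ (r : A → ℝ) (d : (A → ℝ) → A → ℝ), (∀ α, 0 ≤ r α) ∧
      (∀ l ∈ T, d l ∈ witnessedCone X A β l) ∧ c = r + ∑ l ∈ T, d l := by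
  classical
  obtain ⟨hcnn, hcw⟩ := hc
  let f : A → ℝ := fun α => c α / ν α
  have hf : ∀ α, α ≠ β → 0 ≤ f α := fun α hα => div_nonneg (hcnn α hα) (hN.1 α hα)
  let p : (A → ℝ) → ℝ := fun l =>
    (∏ α ∈ Finset.univ.erase β, f α ^ l α) * Real.exp (l ⬝ᵥ y)
  have hprodnn : ∀ l : A → ℝ, 0 ≤ ∏ α ∈ Finset.univ.erase β, f α ^ l α := fun l =>
    Finset.prod_nonneg fun α hα => Real.rpow_nonneg (hf α (Finset.ne_of_mem_erase hα)) _
  let d : (A → ℝ) → A → ℝ := fun l α => if α = β then -(w l * p l) else w l * l α * f α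
  refine ⟨c - ∑ l ∈ T, d l, d, fun α => ?_, fun l hl => ⟨fun α hα => ?_, ?_⟩, by simp⟩
  · simp only [Pi.sub_apply, Finset.sum_apply, sub_nonneg, d]
    split_ifs with hα
    · subst hα
      have amgm := Real.geom_mean_le_arith_mean_weighted T w p hw hw1
        fun l _ => mul_nonneg (hprodnn l) (Real.exp_pos _).le
      have hprod : ∏ l ∈ T, p l ^ w l =
          (∏ γ ∈ Finset.univ.erase α, f γ ^ ν γ) * Real.exp (ν ⬝ᵥ y) := by
        rw [Finset.prod_congr rfl fun l _ => Real.mul_rpow (hprodnn l) (Real.exp_pos _).le,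
          Finset.prod_mul_distrib]
        congr 1
        · rw [Finset.prod_congr rfl fun l _ => (Real.finsetProd_rpow _ _ (fun γ hγ =>
            Real.rpow_nonneg (hf γ (Finset.ne_of_mem_erase hγ)) _) (w l)).symm,
            Finset.prod_comm]
          refine Finset.prod_congr rfl fun γ hγ => ?_
          have hγ := Finset.ne_of_mem_erase hγ
          rw [← hwν, Finset.sum_apply, Real.rpow_sum_of_nonneg (hf γ hγ) fun l hl =>
            show 0 ≤ (w l • l) γ from mul_nonneg (hw l hl) ((hT l hl).1.1 γ hγ)]
          refine Finset.prod_congr rfl fun l _ => ?_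
          rw [← Real.rpow_mul (hf γ hγ), Pi.smul_apply, smul_eq_mul, mul_comm]
        · simp only [← Real.exp_mul, ← Real.exp_sum]
          rw [← hwν, sum_dotProduct]
          simp only [smul_dotProduct, smul_eq_mul, mul_comm]
      rw [hprod, ← prod_filter_pos_rpow hN hβ] at amgm
      rw [hy.supportFun_eq] at hcw
      have := mul_le_mul_of_nonneg_right hcw (Real.exp_pos (ν ⬝ᵥ y)).le
      rw [mul_assoc, ← Real.exp_add, neg_add_cancel, Real.exp_zero, mul_one] at this
      rw [Finset.sum_neg_distrib]
      linarith [this.trans amgm]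
    · have : ∑ l ∈ T, w l * l α = ν α := by rw [← hwν]; simp
      rw [← Finset.sum_mul, this]
      by_cases h0 : ν α = 0
      · rw [h0, zero_mul]
        exact hcnn α hα
      · exact (mul_div_cancel₀ _ h0).le
  · simp only [d, if_neg hα]
    exact mul_nonneg (mul_nonneg (hw l hl) ((hT l hl).1.1 α hα)) (hf α hα)
  · obtain ⟨lN, lβ, ly⟩ := hT l hl
    rw [ly.supportFun_eq, Finset.prod_congr rfl fun α hα => show
      (d l α / l α) ^ l α = w l ^ l α * f α ^ l α by
        have hp := (Finset.mem_filter.1 hα).2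
        have hne := Finset.ne_of_mem_erase (filter_pos_subset_erase lβ hα)
        simp only [d, if_neg hne]
        rw [mul_right_comm, mul_div_cancel_right₀ _ hp.ne',
          Real.mul_rpow (hw l hl) (hf α hne)],
      Finset.prod_mul_distrib, ← Real.rpow_sum_of_nonneg (hw l hl) fun α hα =>
        (Finset.mem_filter.1 hα).2.le, sum_filter_pos lN lβ, Real.rpow_one,
      prod_filter_pos_rpow lN lβ]
    simp only [d, if_true, p, neg_neg]
    rw [mul_assoc, mul_assoc, ← Real.exp_add, add_neg_cancel, Real.exp_zero, mul_one]

end Witnessed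

/-! ### The circuit decomposition of the SAGE cone -/

section Decomposition

variable {n : ℕ} {X : Set (Fin n → ℝ)} {A : Finset (Fin n → ℝ)} {β : A} {c : A → ℝ}

lemma exists_decomposition (hX : IsPolyhedron X) (hne : X.Nonempty) (hc : c ∈ ageCone X A β) :
    ∃ (r : A → ℝ) (d : (A → ℝ) → A → ℝ), (∀ α, 0 ≤ r α) ∧
      (∀ l ∈ (finite_normalizedCircuits hX hne β).toFinset, d l ∈ witnessedCone X A β l) ∧
      c = r + ∑ l ∈ (finite_normalizedCircuits hX hne β).toFinset, d l := by
  classical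
  set L := (finite_normalizedCircuits hX hne β).toFinset
  have hL : ∀ {l}, l ∈ L ↔ l ∈ normalizedCircuits X A β := Set.Finite.mem_toFinset _
  by_cases hcβ : c β < 0
  · obtain ⟨ν, hN, hβ, hfin, hw⟩ := exists_witness hX hne hc hcβ
    obtain ⟨y, T, w, hT, hy, hw0, hw1, hwν⟩ := exists_circuit_combination hX hne hN hβ hfin
    obtain ⟨r, d, hr, hd, hcd⟩ := exists_split hN hβ hy
      (fun l hl => ⟨(hT l hl).1.1.1, (hT l hl).1.2, (hT l hl).2⟩) hw0 hw1 hwν hw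
    refine ⟨r, fun l => if l ∈ T then d l else 0, hr, fun l hl => ?_, ?_⟩
    · dsimp only
      split_ifs with h
      · exact hd l h
      · exact zero_mem_witnessedCone (hL.1 hl).2
    · rw [Finset.sum_ite_mem, Finset.inter_eq_right.2 fun l hl => hL.2 (hT l hl).1]
      exact hcd
  · refine ⟨c, fun _ => 0, fun α => ?_, fun l hl => zero_mem_witnessedCone (hL.1 hl).2, by simp⟩
    by_cases h : α = β
    · rw [h]; exact not_lt.1 hcβ
    · exact hc.1 α h

lemma zero_mem_ageCone : (0 : A → ℝ) ∈ ageCone X A β :=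
  ⟨fun _ _ => le_rfl, fun x _ => by simp [signomial]⟩

lemma add_mem_ageCone {d : A → ℝ} (hc : c ∈ ageCone X A β) (hd : d ∈ ageCone X A β) :
    c + d ∈ ageCone X A β :=
  ⟨fun α hα => add_nonneg (hc.1 α hα) (hd.1 α hα), fun x hx => by
    simpa [signomial, add_mul, Finset.sum_add_distrib] using add_nonneg (hc.2 x hx) (hd.2 x hx)⟩

lemma mem_sageCone_iff : c ∈ sageCone X A ↔ ∃ g : A → A → ℝ, (∀ β, g β ∈ ageCone X A β) ∧
    ∑ β, g β = c := by
  rw [sageCone, Set.mem_finsetSum]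
  exact ⟨fun ⟨g, hg, h⟩ => ⟨g, fun β => hg (Finset.mem_univ β), h⟩,
    fun ⟨g, hg, h⟩ => ⟨g, fun {β} _ => hg β, h⟩⟩

variable (X A) in
/-- The SAGE cone as an additive submonoid. -/
def sageSubmonoid : AddSubmonoid (A → ℝ) where
  carrier := sageCone X A
  zero_mem' := mem_sageCone_iff.2 ⟨0, fun _ => zero_mem_ageCone, by simp⟩
  add_mem' {c d} hc hd := by
    obtain ⟨g, hg, rfl⟩ := mem_sageCone_iff.1 hc
    obtain ⟨g', hg', rfl⟩ := mem_sageCone_iff.1 hd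
    exact mem_sageCone_iff.2 ⟨g + g', fun β => add_mem_ageCone (hg β) (hg' β), by
      simp [Finset.sum_add_distrib]⟩

lemma ageCone_subset_sageCone : ageCone X A β ⊆ sageCone X A := fun c hc => by
  classical
  refine mem_sageCone_iff.2 ⟨fun γ => if γ = β then c else 0, fun γ => ?_, by simp⟩
  dsimp only
  split_ifs with h
  · exact h ▸ hc
  · exact zero_mem_ageCone

lemma nonneg_mem_sageCone (hc : ∀ α, 0 ≤ c α) : c ∈ sageCone X A := by
  rcases isEmpty_or_nonempty A with h | ⟨⟨β⟩⟩
  · rw [Subsingleton.elim c 0]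
    exact (sageSubmonoid X A).zero_mem
  · exact ageCone_subset_sageCone (β := β) ⟨fun α _ => hc α, fun x _ =>
      Finset.sum_nonneg fun α _ => mul_nonneg (hc α) (Real.exp_pos _).le⟩

theorem sageCone_eq_nonneg_add_sum (hX : IsPolyhedron X) (hne : X.Nonempty) :
    sageCone X A = {c : A → ℝ | ∀ α, 0 ≤ c α} +
      ∑ β : A, ∑ l ∈ (finite_normalizedCircuits hX hne β).toFinset, witnessedCone X A β l := by
  ext c
  constructor
  · intro hc
    obtain ⟨g, hg, rfl⟩ := mem_sageCone_iff.1 hc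
    choose r d hr hd hgd using fun β => exists_decomposition hX hne (hg β)
    refine Set.mem_add.2 ⟨∑ β, r β, fun α => ?_,
      ∑ β, ∑ l ∈ (finite_normalizedCircuits hX hne β).toFinset, d β l, ?_, ?_⟩
    · rw [Finset.sum_apply]
      exact Finset.sum_nonneg fun β _ => hr β α
    · exact Set.finsetSum_mem_finsetSum _ _ _ fun β _ =>
        Set.finsetSum_mem_finsetSum _ _ _ fun l hl => hd β l hl
    · rw [← Finset.sum_add_distrib]
      exact Finset.sum_congr rfl fun β _ => (hgd β).symm
  · rintro ⟨r, hr, s, hs, rfl⟩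
    obtain ⟨g, hg, rfl⟩ := (Set.mem_finsetSum _ _ _).1 hs
    refine (sageSubmonoid X A).add_mem (nonneg_mem_sageCone hr)
      ((sageSubmonoid X A).sum_mem fun β hβ => ?_)
    obtain ⟨d, hd, hdg⟩ := (Set.mem_finsetSum _ _ _).1 (hg hβ)
    rw [← hdg]
    refine (sageSubmonoid X A).sum_mem fun l hl => ?_
    have hl' := (Set.Finite.mem_toFinset _).1 hl
    exact ageCone_subset_sageCone (witnessedCone_subset_ageCone hl'.1.1 hl'.2 hl'.1.2.2.1 (hd hl))

theorem sageCone_eq_sum (hX : IsPolyhedron X) (hne : X.Nonempty)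
    (h : ∃ β : A, (normalizedCircuits X A β).Nonempty) :
    sageCone X A =
      ∑ β : A, ∑ l ∈ (finite_normalizedCircuits hX hne β).toFinset, witnessedCone X A β l := by
  classical
  rw [sageCone_eq_nonneg_add_sum hX hne]
  obtain ⟨β, l, hl⟩ := h
  have hlL : l ∈ (finite_normalizedCircuits hX hne β).toFinset := (Set.Finite.mem_toFinset _).2 hl
  -- the summand `witnessedCone X A β l` absorbs the nonnegative orthant
  have habs : {c : A → ℝ | ∀ α, 0 ≤ c α} + witnessedCone X A β l = witnessedCone X A β l := by
    ext c
    constructor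
    · rintro ⟨r, hr, s, hs, rfl⟩
      exact add_mem_witnessedCone hl.2 hr hs
    · intro hc
      exact ⟨0, fun _ => le_rfl, c, hc, zero_add c⟩
  rw [← Finset.add_sum_erase Finset.univ _ (Finset.mem_univ β),
    ← Finset.add_sum_erase (finite_normalizedCircuits hX hne β).toFinset _ hlL,
    ← add_assoc, ← add_assoc, habs]

end Decomposition

/-! ### Calculus of conic representations -/

section Representable

variable {I : Type} {W : I → Type} [∀ i, AddCommGroup (W i)] [∀ i, Module ℝ (W i)]
  (K : ∀ i, Set (W i))

/-- `S` is representable by the family of cones `K`: it is the projection of a set described by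
finitely many constraints `F j (x, u) ∈ K (k j)` with affine maps `F j`. In contrast to
`Sage.HasLift` the constraints are indexed by an arbitrary finite type and the auxiliary variable
`u` ranges over an arbitrary finite-dimensional space, so that representations are easy to combine.
-/
def ConicRepresentable {E : Type} [AddCommGroup E] [Module ℝ E] (S : Set E) : Prop :=
  ∃ (J : Type) (_ : Finite J) (k : J → I) (U : Type) (_ : AddCommGroup U) (_ : Module ℝ U)
    (_ : FiniteDimensional ℝ U) (F : ∀ j, (E × U) →ᵃ[ℝ] W (k j)),
    S = {x | ∃ u, ∀ j, F j (x, u) ∈ K (k j)}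

namespace ConicRepresentable

variable {K} {E E' : Type} [AddCommGroup E] [Module ℝ E] [AddCommGroup E'] [Module ℝ E']

lemma hasLift {ι : Type} [Fintype ι] {S : Set (ι → ℝ)} (hS : ConicRepresentable K S) :
    ∃ (m : ℕ) (k : Fin m → I), HasLift S (fun j => W (k j)) (fun j => K (k j)) := by
  obtain ⟨J, _, k, U, _, _, _, F, rfl⟩ := hS
  obtain ⟨m, ⟨e⟩⟩ := Finite.exists_equiv_fin J
  let b := (Module.finBasis ℝ U).equivFun
  refine ⟨m, fun j => k (e.symm j), Module.finrank ℝ U, fun j => (F (e.symm j)).comp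
    (LinearMap.prodMap LinearMap.id b.symm.toLinearMap).toAffineMap, ?_⟩
  ext x
  constructor
  · rintro ⟨u, hu⟩
    exact ⟨b u, fun j => by simpa using hu (e.symm j)⟩
  · rintro ⟨u, hu⟩
    refine ⟨b.symm u, fun j => ?_⟩
    obtain ⟨i, rfl⟩ := e.symm.surjective j
    exact hu i

lemma of_cone (i : I) (F : E →ᵃ[ℝ] W i) : ConicRepresentable K {x | F x ∈ K i} :=
  ⟨Unit, inferInstance, fun _ => i, Fin 0 → ℝ, inferInstance, inferInstance, inferInstance,
    fun _ => F.comp (LinearMap.fst ℝ E (Fin 0 → ℝ)).toAffineMap, by ext x; simp⟩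

lemma affine_preimage {S : Set E'} (hS : ConicRepresentable K S) (g : E →ᵃ[ℝ] E') :
    ConicRepresentable K {x | g x ∈ S} := by
  obtain ⟨J, _, k, U, _, _, _, F, rfl⟩ := hS
  refine ⟨J, inferInstance, k, U, inferInstance, inferInstance, inferInstance, fun j =>
    (F j).comp ((g.comp (LinearMap.fst ℝ E U).toAffineMap).prod
      (LinearMap.snd ℝ E U).toAffineMap), ?_⟩
  ext x
  rfl

lemma preimage {S : Set E'} (hS : ConicRepresentable K S) {g : E → E'} (hg : IsLinearMap ℝ g) :
    ConicRepresentable K {x | g x ∈ S} :=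
  hS.affine_preimage hg.mk'.toAffineMap

lemma forall_mem {κ : Type} [Finite κ] {S : κ → Set E} (h : ∀ i, ConicRepresentable K (S i)) :
    ConicRepresentable K {x | ∀ i, x ∈ S i} := by
  choose J hJ k U h1 h2 h3 F hS using h
  refine ⟨Σ i, J i, inferInstance, fun p => k p.1 p.2, ∀ i, U i, inferInstance, inferInstance,
    inferInstance, fun p => (F p.1 p.2).comp
      (LinearMap.prodMap LinearMap.id (LinearMap.proj p.1)).toAffineMap, ?_⟩
  ext x
  simp only [hS, Set.mem_ofPred_eq, Sigma.forall]
  constructor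
  · intro h
    choose u hu using h
    exact ⟨u, fun i j => hu i j⟩
  · rintro ⟨u, hu⟩ i
    exact ⟨u i, fun j => hu i j⟩

lemma and {p q : E → Prop} (hp : ConicRepresentable K {x | p x})
    (hq : ConicRepresentable K {x | q x}) : ConicRepresentable K {x | p x ∧ q x} := by
  have h := forall_mem (κ := Bool) (S := fun b => if b then {x | p x} else {x | q x})
    fun b => by cases b <;> simpa
  convert h using 1
  ext x
  simp [and_comm]

lemma exists_mem {V : Type} [AddCommGroup V] [Module ℝ V] [FiniteDimensional ℝ V]
    {S : Set (E × V)} (hS : ConicRepresentable K S) :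
    ConicRepresentable K {x | ∃ v, (x, v) ∈ S} := by
  obtain ⟨J, _, k, U, _, _, _, F, rfl⟩ := hS
  refine ⟨J, inferInstance, k, V × U, inferInstance, inferInstance, inferInstance, fun j =>
    (F j).comp (LinearEquiv.prodAssoc ℝ E V U).symm.toLinearMap.toAffineMap, ?_⟩
  ext x
  simp only [Set.mem_ofPred_eq, Prod.exists]
  rfl

lemma add [FiniteDimensional ℝ E] {S T : Set E} (hS : ConicRepresentable K S)
    (hT : ConicRepresentable K T) : ConicRepresentable K (S + T) := by
  have h := ((hS.preimage (g := fun p : E × E => p.2) ⟨fun _ _ => rfl, fun _ _ => rfl⟩).and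
    (hT.preimage (g := fun p : E × E => p.1 - p.2)
      ⟨fun _ _ => add_sub_add_comm _ _ _ _, fun _ _ => (smul_sub _ _ _).symm⟩)).exists_mem
  convert h using 1
  ext x
  simp only [Set.mem_add, Set.mem_ofPred_eq]
  exact exists_congr fun y => and_congr_right fun _ =>
    ⟨fun ⟨z, hz, hyz⟩ => by rwa [← hyz, add_sub_cancel_left], fun h => ⟨_, h, by abel⟩⟩

variable (K) in
/-- The family `K` can express linear inequalities. -/
abbrev HasHalfline : Prop := ConicRepresentable K {t : ℝ | 0 ≤ t}

lemma zero (h : HasHalfline K) {ι : Type} [Finite ι] :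
    ConicRepresentable K ({0} : Set (ι → ℝ)) := by
  have := forall_mem fun i : ι =>
    (h.preimage (g := fun x : ι → ℝ => x i) ⟨fun _ _ => rfl, fun _ _ => rfl⟩).and
      (h.preimage (g := fun x : ι → ℝ => -x i) ⟨fun _ _ => neg_add _ _, fun _ _ =>
        (mul_neg _ _).symm⟩)
  convert this using 1
  ext x
  simp [le_antisymm_iff, Pi.le_def, and_comm, forall_and]

lemma sum (h : HasHalfline K) {ι : Type} [Finite ι] {κ : Type*} {t : Finset κ}
    {S : κ → Set (ι → ℝ)} (hS : ∀ i ∈ t, ConicRepresentable K (S i)) :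
    ConicRepresentable K (∑ i ∈ t, S i) := by
  classical
  induction t using Finset.induction_on with
  | empty => exact zero h
  | insert a t ha ih =>
    rw [Finset.sum_insert ha]
    exact (hS a (Finset.mem_insert_self a t)).add
      (ih fun i hi => hS i (Finset.mem_insert_of_mem hi))

end ConicRepresentable

/-! ### Conic representations of the SAGE cone -/

/-- The hypograph of the weighted geometric mean, symmetrized in the last variable; for index type
`Fin k` this is `Sage.powerCone`. -/
def geomMeanCone {κ : Type} [Fintype κ] (w : κ → ℝ) : Set ((κ → ℝ) × ℝ) :=
  {z | (∀ i, 0 ≤ z.1 i) ∧ |z.2| ≤ ∏ i, z.1 i ^ w i}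

namespace ConicRepresentable

variable {K}

variable {n : ℕ} {X : Set (Fin n → ℝ)} {A : Finset (Fin n → ℝ)} {β : A} {l : A → ℝ}

lemma witnessedCone (h : HasHalfline K) (hβ : l β = -1)
    (hl : ConicRepresentable K (geomMeanCone fun α : {α // 0 < l α} => l α)) :
    ConicRepresentable K (witnessedCone X A β l) := by
  have hnn : ConicRepresentable K {c : A → ℝ | ∀ α : {α // α ≠ β}, 0 ≤ c α} :=
    forall_mem fun α => h.preimage (g := fun c : A → ℝ => c α) ⟨fun _ _ => rfl, fun _ _ => rfl⟩
  have hex := ((h.preimage (g := fun p : (A → ℝ) × ℝ =>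
      p.2 + p.1 β * Real.exp (supportFun X (-applyExponents A l)))
      ⟨fun p q => by simp only [Prod.snd_add, Prod.fst_add, Pi.add_apply]; ring, fun t p => by
        simp only [Prod.smul_snd, Prod.smul_fst, Pi.smul_apply, smul_eq_mul]; ring⟩).and
    (hl.preimage (g := fun p : (A → ℝ) × ℝ => (fun α => p.1 α / l α, p.2))
      ⟨fun p q => by ext <;> simp [add_div], fun t p => by ext <;> simp [mul_div_assoc]⟩)).exists_mem
  convert hnn.and hex using 1
  ext c
  simp only [Sage.witnessedCone, geomMeanCone, Set.mem_ofPred_eq]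
  rw [show (∀ α : {α // α ≠ β}, 0 ≤ c α) ↔ ∀ α, α ≠ β → 0 ≤ c α from Subtype.forall]
  refine and_congr_right fun hc => ?_
  have hne : ∀ α : {α // 0 < l α}, (α : A) ≠ β := fun α h => by linarith [h ▸ α.2]
  rw [← Finset.prod_subtype_eq_prod_filter (f := fun α => (c α / l α) ^ l α)]
  simp only [Finset.subtype_univ]
  have hP : 0 ≤ ∏ α : {α // 0 < l α}, (c α / l α) ^ l α := Finset.prod_nonneg fun α _ =>
    Real.rpow_nonneg (div_nonneg (hc α (hne α)) α.2.le) _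
  constructor
  · intro hle
    exact ⟨_, by linarith, fun α => div_nonneg (hc α (hne α)) α.2.le,
      (abs_of_nonneg hP).le⟩
  · rintro ⟨t, ht, -, hle⟩
    linarith [le_abs_self t]

theorem sageCone (hX : IsPolyhedron X) (hne : X.Nonempty) (h : HasHalfline K)
    (hl : ∀ (β : A), ∀ l ∈ normalizedCircuits X A β,
      ConicRepresentable K (geomMeanCone fun α : {α // 0 < l α} => l α)) :
    ConicRepresentable K (sageCone X A) := by
  rw [sageCone_eq_nonneg_add_sum hX hne]
  refine add (forall_mem fun α : A => h.preimage (g := fun c : A → ℝ => c α)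
    ⟨fun _ _ => rfl, fun _ _ => rfl⟩) (sum h fun β _ => sum h fun l hmem => ?_)
  have hmem := (Set.Finite.mem_toFinset _).1 hmem
  exact witnessedCone h hmem.2 (hl β l hmem)

end ConicRepresentable

/-! ### Geometric means by rotated quadratic cones -/

/-- The rotated quadratic cone, the hypograph of the geometric mean of two variables. -/
def rotatedCone : Set (ℝ × ℝ × ℝ) :=
  {q | 0 ≤ q.1 ∧ 0 ≤ q.2.1 ∧ q.2.2 ^ 2 ≤ q.1 * q.2.1}

namespace ConicRepresentable

variable {K}

lemma hasHalfline (h : ConicRepresentable K rotatedCone) : HasHalfline K := by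
  convert h.preimage (g := fun t : ℝ => ((t, 0, 0) : ℝ × ℝ × ℝ))
    ⟨fun _ _ => by simp, fun _ _ => by simp⟩ using 1
  ext t
  simp [rotatedCone]

lemma le (h : HasHalfline K) {E : Type} [AddCommGroup E] [Module ℝ E] {f g : E → ℝ}
    (hf : IsLinearMap ℝ f) (hg : IsLinearMap ℝ g) : ConicRepresentable K {x | f x ≤ g x} := by
  convert h.preimage (hg.mk' - hf.mk').isLinear using 1
  ext x
  simp

/-- The unweighted geometric mean of `2 ^ k` variables, by a binary tree of geometric means of two
variables. -/
lemma pow_le_prod (h : ConicRepresentable K rotatedCone) (k : ℕ) :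
    ∀ (J : Type) [Fintype J], Fintype.card J = 2 ^ k →
      ConicRepresentable K
        {z : (J → ℝ) × ℝ | (∀ j, 0 ≤ z.1 j) ∧ 0 ≤ z.2 ∧ z.2 ^ 2 ^ k ≤ ∏ j, z.1 j} := by
  have hsnd : ∀ {J : Type}, IsLinearMap ℝ fun z : (J → ℝ) × ℝ => z.2 :=
    ⟨fun _ _ => rfl, fun _ _ => rfl⟩
  induction k with
  | zero =>
    intro J _ hJ
    obtain ⟨j, hj⟩ := Fintype.card_eq_one_iff.1 hJ
    have hfst : IsLinearMap ℝ fun z : (J → ℝ) × ℝ => z.1 j := ⟨fun _ _ => rfl, fun _ _ => rfl⟩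
    convert (le h.hasHalfline (.mk (fun _ _ => (add_zero _).symm) fun _ _ => (smul_zero _).symm :
      IsLinearMap ℝ fun _ : (J → ℝ) × ℝ => (0 : ℝ)) hsnd).and (le h.hasHalfline hsnd hfst) using 1
    ext z
    have hprod : ∏ i, z.1 i = z.1 j :=
      Fintype.prod_eq_single j fun i hi => absurd (hj i) hi
    simp only [Set.mem_ofPred_eq, pow_zero, pow_one, hprod]
    exact ⟨fun hz => hz.2, fun hz => ⟨fun i => by rw [hj i]; exact hz.1.trans hz.2, hz⟩⟩
  | succ k ih =>
    intro J _ hJ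
    let e : J ≃ Fin (2 ^ k) ⊕ Fin (2 ^ k) := Fintype.equivOfCardEq (by simp [hJ, pow_succ, mul_two])
    have ih := ih (Fin (2 ^ k)) (by simp)
    have hex := ((ih.preimage (g := fun p : ((J → ℝ) × ℝ) × ℝ × ℝ =>
        ((fun i => p.1.1 (e.symm (Sum.inl i)) : Fin (2 ^ k) → ℝ), p.2.1))
        ⟨fun _ _ => rfl, fun _ _ => rfl⟩).and
      ((ih.preimage (g := fun p : ((J → ℝ) × ℝ) × ℝ × ℝ =>
        ((fun i => p.1.1 (e.symm (Sum.inr i)) : Fin (2 ^ k) → ℝ), p.2.2))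
        ⟨fun _ _ => rfl, fun _ _ => rfl⟩).and
      ((h.preimage (g := fun p : ((J → ℝ) × ℝ) × ℝ × ℝ => (p.2.1, p.2.2, p.1.2))
        ⟨fun _ _ => rfl, fun _ _ => rfl⟩).and
      (h.hasHalfline.preimage (g := fun p : ((J → ℝ) × ℝ) × ℝ × ℝ => p.1.2)
        ⟨fun _ _ => rfl, fun _ _ => rfl⟩)))).exists_mem
    convert hex using 1
    ext ⟨y, t⟩
    simp only [rotatedCone, Set.mem_ofPred_eq, Prod.exists]
    have hprod : ∏ j, y j = (∏ i, y (e.symm (Sum.inl i))) * ∏ i, y (e.symm (Sum.inr i)) := by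
      rw [← Fintype.prod_sum_type fun i => y (e.symm i)]
      exact (Equiv.prod_comp e.symm y).symm
    have h2 : (2 : ℕ) ^ k ≠ 0 := by positivity
    constructor
    · rintro ⟨hy, ht, hle⟩
      have hroot : ∀ f : Fin (2 ^ k) → J, ∃ s : ℝ, 0 ≤ s ∧ s ^ 2 ^ k = ∏ i, y (f i) := fun f =>
        ⟨_, Real.rpow_nonneg (Finset.prod_nonneg fun i _ => hy _) _,
          Real.rpow_inv_natCast_pow (Finset.prod_nonneg fun i _ => hy _) h2⟩
      obtain ⟨s₁, hs₁, hp₁⟩ := hroot fun i => e.symm (Sum.inl i)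
      obtain ⟨s₂, hs₂, hp₂⟩ := hroot fun i => e.symm (Sum.inr i)
      refine ⟨s₁, s₂, ⟨fun i => hy _, hs₁, hp₁.le⟩, ⟨fun i => hy _, hs₂, hp₂.le⟩,
        ⟨hs₁, hs₂, ?_⟩, ht⟩
      refine (pow_le_pow_iff_left₀ (sq_nonneg t) (mul_nonneg hs₁ hs₂) h2).1 ?_
      rw [mul_pow, hp₁, hp₂, ← hprod, ← pow_mul, ← pow_succ']
      exact hle
    · rintro ⟨s₁, s₂, ⟨hy₁, hs₁, hp₁⟩, ⟨hy₂, hs₂, hp₂⟩, ⟨-, -, hle⟩, ht⟩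
      refine ⟨fun j => ?_, ht, ?_⟩
      · rcases hj : e j with i | i
        · have := hy₁ i
          rwa [← hj, e.symm_apply_apply] at this
        · have := hy₂ i
          rwa [← hj, e.symm_apply_apply] at this
      · rw [hprod, pow_succ', pow_mul]
        refine (pow_le_pow_left₀ (sq_nonneg t) hle _).trans ?_
        rw [mul_pow]
        exact mul_le_mul hp₁ hp₂ (pow_nonneg hs₂ _) (Finset.prod_nonneg fun i _ => hy₁ i)

lemma exists_common_denominator {κ : Type*} [Fintype κ] (q : κ → ℚ) (hq : ∀ i, 0 < q i) :
    ∃ (D : ℕ) (p : κ → ℕ), 0 < D ∧ ∀ i, 0 < p i ∧ q i * D = p i := by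
  classical
  have hnum : ∀ i, ((q i).num.toNat : ℚ) = (q i).num := fun i => by
    exact_mod_cast Int.toNat_of_nonneg (Rat.num_pos.2 (hq i)).le
  refine ⟨∏ i, (q i).den, fun i => (q i).num.toNat * ∏ j ∈ Finset.univ.erase i, (q j).den,
    Finset.prod_pos fun i _ => (q i).den_pos, fun i => ⟨Nat.mul_pos ?_ ?_, ?_⟩⟩
  · exact Int.pos_iff_toNat_pos.1 (Rat.num_pos.2 (hq i))
  · exact Finset.prod_pos fun j _ => (q j).den_pos
  · rw [← Finset.mul_prod_erase Finset.univ (fun i => (q i).den) (Finset.mem_univ i)]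
    push_cast
    rw [hnum, ← mul_assoc, Rat.mul_den_eq_num]

/-- Rational weights `p i / D` are turned into multiplicities; the number of variables is filled up
to a power of two by copies of the mean itself. -/
lemma geomMeanCone_of_rat (h : ConicRepresentable K rotatedCone) {κ : Type} [Fintype κ]
    {w : κ → ℝ} (hw : ∀ i, 0 < w i) (hw1 : ∑ i, w i = 1) (q : κ → ℚ) (hq : ∀ i, w i = q i) :
    ConicRepresentable K (geomMeanCone w) := by
  obtain ⟨D, p, hD, hp⟩ := exists_common_denominator q fun i => by
    have := hw i
    rw [hq i] at this
    exact_mod_cast this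
  have hwp : ∀ i, w i * D = p i := fun i => by
    rw [hq i]
    exact_mod_cast congrArg (fun r : ℚ => (r : ℝ)) (hp i).2
  have hpD : ∑ i, p i = D := by
    have : (∑ i, (p i : ℝ)) = D := by
      rw [Finset.sum_congr rfl fun i _ => (hwp i).symm, ← Finset.sum_mul, hw1, one_mul]
    exact_mod_cast this
  have hlt : D ≤ 2 ^ D := Nat.lt_two_pow_self.le
  let m : Option κ → ℕ := fun o => o.elim (2 ^ D - D) p
  have hcard : Fintype.card (Σ o, Fin (m o)) = 2 ^ D := by
    simp only [Fintype.card_sigma, Fintype.card_fin, Fintype.sum_option, m, Option.elim_none,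
      Option.elim_some, hpD]
    omega
  have hex := (((pow_le_prod h D _ hcard).preimage (g := fun x : ((κ → ℝ) × ℝ) × ℝ =>
      ((fun j => j.1.elim x.2 x.1.1 : (Σ o, Fin (m o)) → ℝ), x.2))
      ⟨fun x y => by
        ext j
        · rcases j with ⟨_ | i, j⟩ <;> rfl
        · rfl, fun t x => by
        ext j
        · rcases j with ⟨_ | i, j⟩ <;> rfl
        · rfl⟩).and
    ((le h.hasHalfline (f := fun x : ((κ → ℝ) × ℝ) × ℝ => x.1.2) (g := fun x => x.2)
      ⟨fun _ _ => rfl, fun _ _ => rfl⟩ ⟨fun _ _ => rfl, fun _ _ => rfl⟩).and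
    (le h.hasHalfline (f := fun x : ((κ → ℝ) × ℝ) × ℝ => -x.1.2) (g := fun x => x.2)
      ⟨fun _ _ => neg_add _ _, fun _ _ => (smul_neg _ _).symm⟩
      ⟨fun _ _ => rfl, fun _ _ => rfl⟩))).exists_mem
  convert hex using 1
  ext ⟨z, t⟩
  simp only [geomMeanCone, Set.mem_ofPred_eq]
  have hprod : ∀ s : ℝ, ∏ j : (Σ o, Fin (m o)), j.1.elim s z =
      s ^ (2 ^ D - D) * ∏ i, z i ^ p i := fun s => by
    rw [Fintype.prod_sigma]
    simp [Fintype.prod_option, m]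
  have hpow : (∀ i, 0 ≤ z i) → (∏ i, z i ^ w i) ^ D = ∏ i, z i ^ p i := fun hz => by
    rw [← Finset.prod_pow]
    refine Finset.prod_congr rfl fun i _ => ?_
    rw [← Real.rpow_mul_natCast (hz i), hwp, Real.rpow_natCast]
  constructor
  · rintro ⟨hz, ht⟩
    refine ⟨|t|, ⟨?_, abs_nonneg t, ?_⟩, le_abs_self t, neg_le_abs t⟩
    · rintro ⟨_ | i, j⟩
      · exact abs_nonneg t
      · exact hz i
    · rw [hprod, ← hpow hz, ← Nat.sub_add_cancel hlt, pow_add, Nat.add_sub_cancel]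
      gcongr
  · rintro ⟨s, ⟨hz, hs, hle⟩, h1, h2⟩
    have hz : ∀ i, 0 ≤ z i := fun i => hz ⟨some i, ⟨0, (hp i).1⟩⟩
    have hPnn : 0 ≤ ∏ i, z i ^ w i := Finset.prod_nonneg fun i _ => Real.rpow_nonneg (hz i) _
    refine ⟨hz, (abs_le.2 ⟨by linarith, h1⟩).trans ?_⟩
    rcases hs.eq_or_lt with rfl | hs
    · exact hPnn
    · rw [hprod, ← hpow hz, ← Nat.sub_add_cancel hlt, pow_add, Nat.add_sub_cancel] at hle
      exact (pow_le_pow_iff_left₀ hs.le hPnn hD.ne').1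
        (le_of_mul_le_mul_left hle (pow_pos hs _))

end ConicRepresentable

end Representable

/-! ### Power, second-order and semidefinite cones -/

section Families

lemma posSemidef_fin_one_iff (M : Matrix (Fin 1) (Fin 1) ℝ) : M.PosSemidef ↔ 0 ≤ M 0 0 := by
  refine ⟨fun h => h.diag_nonneg, fun h => ?_⟩
  have : M = Matrix.diagonal fun _ => M 0 0 := by
    ext i j
    simp [Subsingleton.elim i 0, Subsingleton.elim j 0]
  rw [this]
  exact Matrix.PosSemidef.diagonal fun _ => h

lemma posSemidef_fin_two_iff (a b s : ℝ) :
    (!![a, s; s, b] : Matrix (Fin 2) (Fin 2) ℝ).PosSemidef ↔ (a, b, s) ∈ rotatedCone := by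
  constructor
  · intro h
    have hdet := h.det_nonneg
    rw [Matrix.det_fin_two_of] at hdet
    exact ⟨h.diag_nonneg (i := 0), h.diag_nonneg (i := 1), by nlinarith⟩
  · rintro ⟨ha, hb, hs⟩
    refine Matrix.PosSemidef.of_dotProduct_mulVec_nonneg ?_ fun x => ?_
    · ext i j
      fin_cases i <;> fin_cases j <;> simp
    · simp only [dotProduct, Matrix.mulVec, Fin.sum_univ_two, Pi.star_apply, star_trivial,
        Matrix.of_apply, Matrix.cons_val', Matrix.cons_val_zero, Matrix.cons_val_one,
        Matrix.cons_val_fin_one]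
      simp only at ha hb hs
      rcases ha.eq_or_lt with rfl | ha
      · have hs0 : s = 0 := by nlinarith
        subst hs0
        nlinarith [mul_nonneg hb (sq_nonneg (x 1))]
      · refine nonneg_of_mul_nonneg_right ?_ ha
        nlinarith [sq_nonneg (a * x 0 + s * x 1), mul_nonneg (sub_nonneg.2 hs) (sq_nonneg (x 1))]

/-- The family consisting of the cone of positive semidefinite matrices of size `k`. -/
abbrev semidefiniteFamily (k : ℕ) (_ : Unit) : Set (Matrix (Fin k) (Fin k) ℝ) :=
  {M | M.PosSemidef}

lemma ConicRepresentable.hasSemidefiniteLift {ι : Type} [Fintype ι] {S : Set (ι → ℝ)} {k : ℕ}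
    (h : ConicRepresentable (semidefiniteFamily k) S) : HasSemidefiniteLift S k := by
  obtain ⟨m, _, h⟩ := h.hasLift
  exact ⟨m, h⟩

lemma representable_rotatedCone_semidefinite :
    ConicRepresentable (semidefiniteFamily 2) rotatedCone := by
  have hg : IsLinearMap ℝ fun q : ℝ × ℝ × ℝ => !![q.1, q.2.2; q.2.2, q.2.1] :=
    ⟨fun p q => by ext i j; fin_cases i <;> fin_cases j <;> simp,
      fun t q => by ext i j; fin_cases i <;> fin_cases j <;> simp⟩
  convert ConicRepresentable.of_cone (K := semidefiniteFamily 2) () hg.mk'.toAffineMap using 1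
  ext ⟨a, b, s⟩
  exact (posSemidef_fin_two_iff a b s).symm

lemma mem_rotatedCone_iff (a b s : ℝ) : (a, b, s) ∈ rotatedCone ↔
    √((2 * s) ^ 2 + (a - b) ^ 2) ≤ a + b := by
  rw [Real.sqrt_le_iff]
  constructor
  · rintro ⟨ha, hb, hs⟩
    simp only at ha hb hs
    exact ⟨add_nonneg ha hb, by nlinarith⟩
  · rintro ⟨h, hs⟩
    have hab : s ^ 2 ≤ a * b := by nlinarith
    refine ⟨?_, ?_, hab⟩
    · by_contra! ha
      simp only at ha
      nlinarith [sq_nonneg s]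
    · by_contra! hb
      simp only at hb
      nlinarith [sq_nonneg s]

lemma representable_rotatedCone_lorentz : ConicRepresentable lorentzCone rotatedCone := by
  have hg : IsLinearMap ℝ fun q : ℝ × ℝ × ℝ =>
      ((![2 * q.2.2, q.1 - q.2.1], q.1 + q.2.1) : (Fin 2 → ℝ) × ℝ) := by
    constructor
    · intro p q
      ext i
      · fin_cases i <;> simp <;> ring
      · simp only [Prod.fst_add, Prod.snd_add]; ring
    · intro t q
      ext i
      · fin_cases i <;> simp <;> ring
      · simp only [Prod.smul_fst, Prod.smul_snd, smul_eq_mul]; ring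
  convert ConicRepresentable.of_cone (K := lorentzCone) 2 hg.mk'.toAffineMap using 1
  ext ⟨a, b, s⟩
  simp [mem_rotatedCone_iff, lorentzCone]

/-- The family of all power cones. -/
abbrev powerFamily
    (i : {p : Σ k : ℕ, Fin k → ℝ // (∀ j, 0 < p.2 j) ∧ ∑ j, p.2 j = 1}) :
    Set ((Fin i.1.1 → ℝ) × ℝ) :=
  powerCone i.1.2

lemma representable_geomMeanCone_power {κ : Type} [Fintype κ] {w : κ → ℝ} (hw : ∀ i, 0 < w i)
    (hw1 : ∑ i, w i = 1) : ConicRepresentable powerFamily (geomMeanCone w) := by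
  let e := Fintype.equivFin κ
  have hg : IsLinearMap ℝ fun z : (κ → ℝ) × ℝ => ((fun i => z.1 (e.symm i), z.2) :
      (Fin (Fintype.card κ) → ℝ) × ℝ) := ⟨fun _ _ => rfl, fun _ _ => rfl⟩
  convert ConicRepresentable.of_cone (K := powerFamily)
    ⟨⟨Fintype.card κ, fun i => w (e.symm i)⟩, fun i => hw _, by
      rw [← hw1]; exact Equiv.sum_comp e.symm w⟩ hg.mk'.toAffineMap using 1
  ext z
  simp only [geomMeanCone, powerCone, Set.mem_ofPred_eq, LinearMap.coe_toAffineMap,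
    IsLinearMap.mk'_apply]
  rw [Equiv.prod_comp e.symm fun i => z.1 i ^ w i, e.symm.forall_congr_left]
  simp

lemma hasHalfline_power : ConicRepresentable.HasHalfline powerFamily := by
  convert (representable_geomMeanCone_power (κ := Unit) (w := fun _ => 1) (by simp)
    (by simp)).preimage (g := fun t : ℝ => ((fun _ => t, 0) : (Unit → ℝ) × ℝ))
    ⟨fun _ _ => by ext <;> simp, fun _ _ => by ext <;> simp⟩ using 1
  ext t
  simp [geomMeanCone]

/-! ### Semidefinite lifts of size at most one -/

variable {ι : Type} [Fintype ι] {S : Set (ι → ℝ)}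

lemma isPolyhedron_of_hasSemidefiniteLift_zero (h : HasSemidefiniteLift S 0) :
    IsPolyhedron S := by
  obtain ⟨m, p, F, rfl⟩ := h
  refine ⟨0, 0, 0, ?_⟩
  ext x
  simp only [Set.mem_ofPred_eq]
  refine ⟨fun _ i => i.elim0, fun _ => ⟨0, fun j => ?_⟩⟩
  rw [Subsingleton.elim (F j (x, 0)) 0]
  exact Matrix.PosSemidef.zero

lemma isPolyhedron_of_hasSemidefiniteLift_one (h : HasSemidefiniteLift S 1) :
    IsPolyhedron S := by
  obtain ⟨m, p, F, rfl⟩ := h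
  rw [← isPolyhedral_iff_isPolyhedron]
  refine IsPolyhedral.exists (S := {z | ∀ j, z ∈ F j ⁻¹' {M | M.PosSemidef}})
    (isPolyhedral_iInter fun j => IsPolyhedral.comap ?_ (F j))
  convert isPolyhedral_le (-Matrix.entryLinearMap ℝ ℝ (0 : Fin 1) (0 : Fin 1)) 0 using 1
  ext M
  simp [posSemidef_fin_one_iff]

lemma hasSemidefiniteLift_one_of_isPolyhedron (h : IsPolyhedron S) : HasSemidefiniteLift S 1 := by
  rw [← isPolyhedral_iff_isPolyhedron] at h
  obtain ⟨J, _, f, b, rfl⟩ := h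
  refine ConicRepresentable.hasSemidefiniteLift ?_
  have hg : IsLinearMap ℝ fun t : ℝ => (Matrix.of fun _ _ => t : Matrix (Fin 1) (Fin 1) ℝ) :=
    ⟨fun _ _ => rfl, fun _ _ => rfl⟩
  convert ConicRepresentable.forall_mem fun j => ConicRepresentable.of_cone
    (K := semidefiniteFamily 1) () (hg.mk'.toAffineMap.comp
      (AffineMap.const ℝ (ι → ℝ) (b j) - (f j).toAffineMap)) using 1
  ext x
  simp [posSemidef_fin_one_iff]

lemma semidefiniteExtensionDegree_le {k : ℕ} (h : HasSemidefiniteLift S k) :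
    semidefiniteExtensionDegree S ≤ k :=
  sInf_le ⟨k, h, rfl⟩

/-- If a semidefinite lift of size two exists, then size two is needed exactly for sets which are
not polyhedra, since lifts of size at most one describe projections of polyhedra. -/
lemma semidefiniteExtensionDegree_eq_two_iff (h : HasSemidefiniteLift S 2) :
    semidefiniteExtensionDegree S = 2 ↔ ¬ IsPolyhedron S := by
  constructor
  · intro h2 hS
    have := semidefiniteExtensionDegree_le (hasSemidefiniteLift_one_of_isPolyhedron hS)
    rw [h2] at this
    exact absurd this (by norm_num)
  · intro hS
    refine le_antisymm (semidefiniteExtensionDegree_le h) (le_sInf ?_)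
    rintro _ ⟨k, hk, rfl⟩
    match k, hk with
    | 0, hk => exact absurd (isPolyhedron_of_hasSemidefiniteLift_zero hk) hS
    | 1, hk => exact absurd (isPolyhedron_of_hasSemidefiniteLift_one hk) hS
    | k + 2, _ => exact Nat.cast_le.2 (Nat.le_add_left 2 k)

end Families

/-! ### Representability of the SAGE cone -/

section Main

variable {n : ℕ} {X : Set (Fin n → ℝ)} {A : Finset (Fin n → ℝ)}

lemma sum_subtype_pos {β : A} {l : A → ℝ} (hl : l ∈ normalizedCircuits X A β) :
    ∑ α : {α // 0 < l α}, l α = 1 := by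
  rw [← sum_filter_pos hl.1.1 hl.2, ← Finset.sum_subtype_eq_sum_filter, Finset.subtype_univ]

lemma powerConeRepresentable_sageCone (hX : IsPolyhedron X) (hne : X.Nonempty) :
    PowerConeRepresentable (sageCone X A) := by
  obtain ⟨m, k, h⟩ := (ConicRepresentable.sageCone hX hne hasHalfline_power fun β l hl =>
    representable_geomMeanCone_power (fun α => α.2) (sum_subtype_pos hl)).hasLift
  exact ⟨m, fun j => (k j).1.1, fun j => (k j).1.2, fun j => (k j).2.1, fun j => (k j).2.2, h⟩

/-- In the rational case the SAGE cone is representable by every family of cones which can express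
the geometric mean of two variables. -/
lemma conicRepresentable_sageCone_of_rational (hX : IsPolyhedron X) (hne : X.Nonempty)
    (hrat : IsRationalPolyhedron (transposeImage A X)) {I : Type} {W : I → Type}
    [∀ i, AddCommGroup (W i)] [∀ i, Module ℝ (W i)] {K : ∀ i, Set (W i)}
    (hK : ConicRepresentable K rotatedCone) : ConicRepresentable K (sageCone X A) := by
  refine ConicRepresentable.sageCone hX hne hK.hasHalfline fun β l hl => ?_
  obtain ⟨q, hq⟩ := exists_rat_of_mem_normalizedCircuits hX hne hrat hl
  exact ConicRepresentable.geomMeanCone_of_rat hK (fun α => α.2) (sum_subtype_pos hl)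
    (fun α => q α) fun α => congrFun hq α

end Main

theorem corollary4p5 {n : ℕ} (A : Finset (Fin n → ℝ)) (X : Set (Fin n → ℝ))
    (hX : IsPolyhedron X) (hne : X.Nonempty) :
    (∃ hfin : ∀ β : A, (normalizedCircuits X A β).Finite,
      sageCone X A = {c : A → ℝ | ∀ α, 0 ≤ c α} +
        ∑ β : A, ∑ l ∈ (hfin β).toFinset, witnessedCone X A β l ∧
      ((∃ β : A, (normalizedCircuits X A β).Nonempty) →
        sageCone X A = ∑ β : A, ∑ l ∈ (hfin β).toFinset, witnessedCone X A β l)) ∧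
    PowerConeRepresentable (sageCone X A) ∧
    (IsRationalPolyhedron (transposeImage A X) →
      SecondOrderRepresentable (sageCone X A) ∧
      semidefiniteExtensionDegree (sageCone X A) ≤ 2 ∧
      (semidefiniteExtensionDegree (sageCone X A) = 2 ↔ ¬ IsPolyhedron (sageCone X A))) := by
  refine ⟨⟨finite_normalizedCircuits hX hne, sageCone_eq_nonneg_add_sum hX hne,
    sageCone_eq_sum hX hne⟩, powerConeRepresentable_sageCone hX hne, fun hrat => ?_⟩
  have hsdp : HasSemidefiniteLift (sageCone X A) 2 :=
    (conicRepresentable_sageCone_of_rational hX hne hrat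
      representable_rotatedCone_semidefinite).hasSemidefiniteLift
  exact ⟨(conicRepresentable_sageCone_of_rational hX hne hrat
      representable_rotatedCone_lorentz).hasLift,
    semidefiniteExtensionDegree_le hsdp, semidefiniteExtensionDegree_eq_two_iff hsdp⟩
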